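/- Let $G$ be a directed acyclic graph with $n$ vertices and $m$ arcs. For vertices $u \ne v$, a vertex $s$ is a \emph{junction} of the pair $(u,v)$ if there are a directed path from $s$ to $u$ and a directed path from $s$ to $v$ that are internally disjoint, i.e. no internal vertex of one of them lies on the other (a path may consist of a single vertex; a pair $(u,u)$ has no junction). The graph is given by the adjacency lists of the children of its vertices $0,\dots,n-1$, stored in arrays; an algorithm is a program for a random access machine whose memory outside the input is initially $0$, and its running time is the number of elementary steps. (a) There is an algorithm which, given $G$, a vertex $s$ of $G$ and $k \ge 0$ pairs of vertices $(u_1,v_1),\dots,(u_k,v_k)$ of $G$, determines for every $i$ with $1 \le i \le k$ whether $s$ is a junction of $(u_i,v_i)$, in time at most $C(m+k+1)$, where $C$ is an absolute constant; that is, in $O(m+k)$ time (if $k \ge 1$, the summand $1$ can be dropped after doubling $C$). (b) There is an algorithm for the problem $k$-pairs-all-junctions which, given $G$ and $k \ge 0$ pairs of vertices $(u_1,v_1),\dots,(u_k,v_k)$ of $G$, lists for every $i$ with $1 \le i \le k$ all junctions of $(u_i,v_i)$, each exactly once, in time at most $C(n(m+k)+1)$, where $C$ is an absolute constant; that is, in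 $O(n(m+k))$ time. -/

import Mathlib

/-! ### Directed acyclic graphs and junctions -/

namespace JunctionDAG

/-- A digraph is acyclic if it has no closed directed walk of positive length. -/
def IsDAG {V : Type*} (G : Digraph V) : Prop :=
  ∀ v : V, ¬ Relation.TransGen G.Adj v v

/-- The number of arcs of a digraph. -/
noncomputable def arcCount {V : Type*} (G : Digraph V) : ℕ :=
  Set.ncard {e : V × V | G.Adj e.1 e.2}

/-- `P` is the vertex list of a directed path of `G` from `u` to `v`
(a one-vertex path is allowed; it has `u = v`). -/
def IsDirPath {V : Type*} (G : Digraph V) (u v : V) (P : List V) : Prop :=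
  P.IsChain G.Adj ∧ P.Nodup ∧ P.head? = some u ∧ P.getLast? = some v

/-- `x` is an end vertex (first or last vertex) of the path `P`. -/
def IsEnd {V : Type*} (P : List V) (x : V) : Prop :=
  P.head? = some x ∨ P.getLast? = some x

/-- Two paths are internally disjoint if no internal vertex of one of them is a vertex of the
other: every common vertex is an end vertex of both. -/
def InternallyDisjoint {V : Type*} (P Q : List V) : Prop :=
  ∀ x, x ∈ P → x ∈ Q → IsEnd P x ∧ IsEnd Q x

/-- `s` is a junction of the pair `u, v`. There is no junction of a pair `u, u`. -/
def IsJunction {V : Type*} (G : Digraph V) (s u v : V) : Prop :=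
  u ≠ v ∧ ∃ P Q : List V, IsDirPath G s u P ∧ IsDirPath G s v Q ∧ InternallyDisjoint P Q

/-! ### A random access machine with a step count

Programs work on finitely many registers and finitely many arrays of natural numbers (a program
text mentions only finitely many of them). The only arithmetic operations are `+1` and `-1`, so
that no cell ever exceeds the largest input number or program constant plus the number of steps
made: numbers of `O(log N)` bits suffice, and every step is a bounded number of operations of any
usual random access machine. -/

/-- The memory: registers, and arrays addressed by array number and index. -/
structure State where
  reg : ℕ → ℕ
  arr : ℕ → ℕ → ℕ

/-- Assign a value to a register. -/
def State.setReg (σ : State) (x a : ℕ) : State :=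
  { reg := Function.update σ.reg x a, arr := σ.arr }

/-- Assign a value to cell `i` of array `A`. -/
def State.setArr (σ : State) (A i a : ℕ) : State :=
  { reg := σ.reg, arr := Function.update σ.arr A (Function.update (σ.arr A) i a) }

/-- Elementary operations on registers `x`, `y` and an array `A`. -/
inductive Op : Type
  /-- `x := c` for a constant `c` of the program. -/
  | const (x c : ℕ) : Op
  /-- `x := y` -/
  | copy (x y : ℕ) : Op
  /-- `x := x + 1` -/
  | inc (x : ℕ) : Op
  /-- `x := x - 1` (and `0` stays `0`). -/
  | dec (x : ℕ) : Op
  /-- `x := A[y]` -/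
  | load (x A y : ℕ) : Op
  /-- `A[x] := y` -/
  | store (A x y : ℕ) : Op

/-- The effect of an elementary operation. -/
def Op.apply : Op → State → State
  | .const x c, σ => σ.setReg x c
  | .copy x y, σ => σ.setReg x (σ.reg y)
  | .inc x, σ => σ.setReg x (σ.reg x + 1)
  | .dec x, σ => σ.setReg x (σ.reg x - 1)
  | .load x A y, σ => σ.setReg x (σ.arr A (σ.reg y))
  | .store A x y, σ => σ.setArr A (σ.reg x) (σ.reg y)

/-- Elementary tests on registers. -/
inductive Test : Type
  /-- `x = y` -/
  | eq (x y : ℕ) : Test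
  /-- `x < y` -/
  | lt (x y : ℕ) : Test

/-- The truth of an elementary test. -/
def Test.Holds : Test → State → Prop
  | .eq x y, σ => σ.reg x = σ.reg y
  | .lt x y, σ => σ.reg x < σ.reg y

/-- Programs. -/
inductive Program : Type
  | skip : Program
  | op (o : Op) : Program
  | seq (p q : Program) : Program
  | ite (b : Test) (p q : Program) : Program
  | loop (b : Test) (p : Program) : Program

/-- `Runs p σ σ' t`: started in the state `σ`, the program `p` halts in the state `σ'` after
exactly `t` steps, where every elementary operation, every `skip` and every evaluation of a test
is one step. (`loop b p` is `while b do p`.) -/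
inductive Runs : Program → State → State → ℕ → Prop
  | skip (σ : State) : Runs .skip σ σ 1
  | op (o : Op) (σ : State) : Runs (.op o) σ (o.apply σ) 1
  | seq {p q : Program} {σ σ₁ σ₂ : State} {t₁ t₂ : ℕ} :
      Runs p σ σ₁ t₁ → Runs q σ₁ σ₂ t₂ → Runs (.seq p q) σ σ₂ (t₁ + t₂)
  | iteTrue {b : Test} {p q : Program} {σ σ' : State} {t : ℕ} :
      b.Holds σ → Runs p σ σ' t → Runs (.ite b p q) σ σ' (t + 1)
  | iteFalse {b : Test} {p q : Program} {σ σ' : State} {t : ℕ} :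
      ¬ b.Holds σ → Runs q σ σ' t → Runs (.ite b p q) σ σ' (t + 1)
  | loopTrue {b : Test} {p : Program} {σ σ₁ σ₂ : State} {t₁ t₂ : ℕ} :
      b.Holds σ → Runs p σ σ₁ t₁ → Runs (.loop b p) σ₁ σ₂ t₂ →
      Runs (.loop b p) σ σ₂ (t₁ + t₂ + 1)
  | loopFalse {b : Test} {p : Program} {σ : State} :
      ¬ b.Holds σ → Runs (.loop b p) σ σ 1

/-- The machine is deterministic: final state and running time are determined by the program and
the initial state. -/
theorem Runs.deterministic {p : Program} {σ σ₁ σ₂ : State} {t₁ t₂ : ℕ}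
    (h₁ : Runs p σ σ₁ t₁) (h₂ : Runs p σ σ₂ t₂) : σ₁ = σ₂ ∧ t₁ = t₂ := by
  induction h₁ generalizing σ₂ t₂ with
  | skip σ => cases h₂; exact ⟨rfl, rfl⟩
  | op o σ => cases h₂; exact ⟨rfl, rfl⟩
  | seq _ _ ih₁ ih₂ =>
    cases h₂ with
    | seq a b =>
      obtain ⟨rfl, rfl⟩ := ih₁ a
      obtain ⟨rfl, rfl⟩ := ih₂ b
      exact ⟨rfl, rfl⟩
  | iteTrue hb _ ih =>
    cases h₂ with
    | iteTrue _ a => obtain ⟨rfl, rfl⟩ := ih a; exact ⟨rfl, rfl⟩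
    | iteFalse hb' _ => exact absurd hb hb'
  | iteFalse hb _ ih =>
    cases h₂ with
    | iteTrue hb' _ => exact absurd hb' hb
    | iteFalse _ a => obtain ⟨rfl, rfl⟩ := ih a; exact ⟨rfl, rfl⟩
  | loopTrue hb _ _ ih₁ ih₂ =>
    cases h₂ with
    | loopTrue _ a b =>
      obtain ⟨rfl, rfl⟩ := ih₁ a
      obtain ⟨rfl, rfl⟩ := ih₂ b
      exact ⟨rfl, rfl⟩
    | loopFalse hb' => exact absurd hb hb'
  | loopFalse hb =>
    cases h₂ with
    | loopTrue hb' _ _ => exact absurd hb' hb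
    | loopFalse _ => exact ⟨rfl, rfl⟩

/-- The initial state with the given contents of the first registers and of the first arrays;
all other registers and cells are `0`. -/
def State.init (regs : List ℕ) (arrs : List (List ℕ)) : State :=
  { reg := fun x => regs.getD x 0
    arr := fun A i => (arrs.getD A []).getD i 0 }

/-! ### Input and output formats -/

/-- `adj` is a family of adjacency lists of `G`: the list of `u` contains, in an arbitrary order,
every child of `u` exactly once. -/
def IsAdjLists {n : ℕ} (G : Digraph (Fin n)) (adj : Fin n → List (Fin n)) : Prop :=
  ∀ u, (adj u).Nodup ∧ ∀ v, v ∈ adj u ↔ G.Adj u v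

/-- The concatenation of the adjacency lists of the vertices `0, 1, …, n - 1`. -/
def targets {n : ℕ} (adj : Fin n → List (Fin n)) : List ℕ :=
  (List.ofFn adj).flatten.map Fin.val

/-- The list of the `n + 1` numbers `off 0, …, off n` for which the adjacency list of `u` occupies
the positions `off u, …, off (u + 1) - 1` of `targets adj`. -/
def offsets {n : ℕ} (adj : Fin n → List (Fin n)) : List ℕ :=
  (List.range (n + 1)).map fun u => ((List.ofFn adj).take u).flatten.length

/-- The input arrays: `0` and `1` hold the adjacency lists, `2` and `3` hold the first and the
second vertices of the `k` pairs. -/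
def inputArrays {n k : ℕ} (adj : Fin n → List (Fin n)) (pairs : Fin k → Fin n × Fin n) :
    List (List ℕ) :=
  [offsets adj, targets adj, List.ofFn fun i => ((pairs i).1 : ℕ),
    List.ofFn fun i => ((pairs i).2 : ℕ)]

/-- The input of the single-vertex problem: `n`, `m`, `k`, `s` are in the registers `0` to `3`. -/
noncomputable def singleInput {n k : ℕ} (G : Digraph (Fin n)) (adj : Fin n → List (Fin n))
    (s : Fin n) (pairs : Fin k → Fin n × Fin n) : State :=
  State.init [n, arcCount G, k, (s : ℕ)] (inputArrays adj pairs)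

/-- The answer of the single-vertex problem: for `i < k`, cell `i` of array `4` is `1` if `s` is a
junction of the `i`-th pair, and `0` if not. -/
def SingleAnswer {n k : ℕ} (G : Digraph (Fin n)) (s : Fin n) (pairs : Fin k → Fin n × Fin n)
    (σ : State) : Prop :=
  ∀ i : Fin k,
    (IsJunction G s (pairs i).1 (pairs i).2 → σ.arr 4 i = 1) ∧
    (¬ IsJunction G s (pairs i).1 (pairs i).2 → σ.arr 4 i = 0)

/-- The input of the `k`-pairs-all-junctions problem: `n`, `m`, `k` are in the registers `0` to
`2`. -/
noncomputable def allInput {n k : ℕ} (G : Digraph (Fin n)) (adj : Fin n → List (Fin n))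
    (pairs : Fin k → Fin n × Fin n) : State :=
  State.init [n, arcCount G, k] (inputArrays adj pairs)

/-- The answer of the `k`-pairs-all-junctions problem: for `i < k`, the cells of array `6` from
position `arr 4 i` up to, not including, position `arr 5 i` list all junctions of the `i`-th pair,
each of them exactly once. -/
def AllAnswer {n k : ℕ} (G : Digraph (Fin n)) (pairs : Fin k → Fin n × Fin n)
    (σ : State) : Prop :=
  ∀ i : Fin k, ∃ L : List (Fin n), L.Nodup ∧
    (∀ s, s ∈ L ↔ IsJunction G s (pairs i).1 (pairs i).2) ∧
    σ.arr 5 i = σ.arr 4 i + L.length ∧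
    ∀ (j : ℕ) (hj : j < L.length), σ.arr 6 (σ.arr 4 i + j) = (L[j] : ℕ)

end JunctionDAG

/-! Fix `s`, and let every vertex `w ≠ s` reachable from `s` belong to the child of `s` in the
dominator tree below which it lies. If `u` and `v` belong to the same child `x`, then `x ≠ s` lies
on every path from `s` to `u` and to `v`, so internally disjoint paths force `u = x = v`. If they
belong to different children, there are paths that meet only in `s` (`IsLabeling.exists_paths`).
Label each reachable vertex by `x + 1`, the root by `s + 1` and all other vertices by `0`; then a
query is a comparison of two labels (`IsLabeling.isJunction_iff`).

The tree itself is not needed. An arc from `s` to `w` proposes the label `w + 1`, an arc from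
another reachable `p` proposes the label of `p`. If all proposals agree, this is the label of `w`;
if two differ, no single child of `s` dominates all predecessors, so `w` is itself a child and gets
`w + 1`. In an acyclic graph the proposals can be evaluated in topological order: one traversal
counts the in-degrees within the part reachable from `s`, a second one releases a vertex when its
counter returns to `0` (`LabelInv.insert_arc`).

Both traversals touch only reachable vertices, of which there are at most `m + 1`, and memory starts
at `0`; hence the time is `O(m + 1)` without a term `n` (`computeLabels_spec`), and each pair costs
`O(1)` more (`forPairs_spec`). For all junctions this is repeated for every `s`. The counters are
then `0` by themselves, the labels are erased along the queue, and pair `i` owns a block of `n`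
output cells. Programs are verified by weakest preconditions for loop-free code and by invariants
with step bounds for loops. -/

namespace JunctionDAG

/-! ### Paths in acyclic digraphs, dominator labels and junctions. -/

section Graph

variable {V : Type*} {G : Digraph V}

theorem IsDAG.irrefl_of_reach (hG : IsDAG G) {a b : V} (h : Relation.ReflTransGen G.Adj a b)
    (hba : G.Adj b a) : False :=
  hG a (Relation.TransGen.tail' h hba)

/-- A finite acyclic digraph has a topological numbering. -/
theorem IsDAG.exists_rank [Finite V] (hG : IsDAG G) :
    ∃ r : V → ℕ, ∀ a b, G.Adj a b → r a < r b := by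
  refine ⟨fun v => Set.ncard {a | Relation.TransGen G.Adj a v}, fun a b hab => ?_⟩
  refine Set.ncard_lt_ncard ⟨fun x hx => hx.tail hab, fun h => ?_⟩ (Set.toFinite _)
  exact hG a (h (Relation.TransGen.single hab))

theorem rank_le_of_reach {r : V → ℕ} (hr : ∀ a b, G.Adj a b → r a < r b) {a b : V}
    (h : Relation.ReflTransGen G.Adj a b) : r a ≤ r b := by
  induction h with
  | refl => exact le_rfl
  | tail _ h ih => exact ih.trans (hr _ _ h).le

theorem isDirPath_singleton (s : V) : IsDirPath G s s [s] := by
  simp [IsDirPath]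

theorem IsDirPath.reach_of_mem {s u x : V} {P : List V} (h : IsDirPath G s u P) (hx : x ∈ P) :
    Relation.ReflTransGen G.Adj s x ∧ Relation.ReflTransGen G.Adj x u := by
  obtain ⟨hc, -, hh, hl⟩ := h
  induction P generalizing s x with
  | nil => simp at hx
  | cons a P ih =>
    obtain rfl : a = s := by simpa using hh
    cases P with
    | nil =>
      obtain rfl : a = u := by simpa using hl
      obtain rfl : x = a := by simpa using hx
      exact ⟨.refl, .refl⟩
    | cons b P =>
      rw [List.isChain_cons_cons] at hc
      have hl' : (b :: P).getLast? = some u := by simpa using hl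
      rcases List.mem_cons.1 hx with rfl | hx
      · exact ⟨.refl, (ih (s := b) (x := b) (by simp) hc.2 rfl hl').2.head hc.1⟩
      · have := ih hx hc.2 rfl hl'
        exact ⟨this.1.head hc.1, this.2⟩

theorem IsDirPath.end_mem {s u : V} {P : List V} (h : IsDirPath G s u P) : u ∈ P :=
  List.mem_of_getLast? h.2.2.2

theorem IsDirPath.reach {s u : V} {P : List V} (h : IsDirPath G s u P) :
    Relation.ReflTransGen G.Adj s u :=
  (h.reach_of_mem h.end_mem).1

/-- Were `w` already on the path, its remaining part and the arc from `p` to `w` would form a cycle.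
-/
theorem IsDirPath.concat (hG : IsDAG G) {s p w : V} {P : List V} (h : IsDirPath G s p P)
    (hw : G.Adj p w) : IsDirPath G s w (P ++ [w]) := by
  have hn : w ∉ P := fun hm => hG.irrefl_of_reach (h.reach_of_mem hm).2 hw
  obtain ⟨hc, hd, hh, hl⟩ := h
  refine ⟨?_, ?_, ?_, by simp⟩
  · refine hc.append (by simp) ?_
    simp [hl, hw]
  · exact List.nodup_append.2 ⟨hd, by simp, by
      intro a ha b hb; rw [List.mem_singleton.1 hb]; rintro rfl; exact hn ha⟩
  · simp [hh]

theorem IsDirPath.exists_pred {s w : V} {P : List V} (h : IsDirPath G s w P) (hw : w ≠ s) :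
    ∃ p P', P = P' ++ [w] ∧ IsDirPath G s p P' ∧ G.Adj p w := by
  obtain ⟨hc, hd, hh, hl⟩ := h
  obtain ⟨P', rfl⟩ := List.getLast?_eq_some_iff.1 hl
  rcases List.eq_nil_or_concat P' with rfl | ⟨P'', p, rfl⟩
  · simp at hh; exact absurd hh hw
  · refine ⟨p, _, rfl, ⟨?_, ?_, ?_, by simp⟩, ?_⟩
    · exact hc.left_of_append
    · exact (List.nodup_append.1 hd).1
    · simpa using hh
    · have := (List.isChain_append.1 hc).2.2
      exact this p (by simp) w (by simp)

theorem exists_isDirPath (hG : IsDAG G) {s u : V} (h : Relation.ReflTransGen G.Adj s u) :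
    ∃ P, IsDirPath G s u P := by
  induction h with
  | refl => exact ⟨_, isDirPath_singleton s⟩
  | tail _ h ih =>
    obtain ⟨P, hP⟩ := ih
    exact ⟨_, hP.concat hG h⟩

theorem exists_pred_of_reach {s w : V} (h : Relation.ReflTransGen G.Adj s w) (hw : w ≠ s) :
    ∃ p, Relation.ReflTransGen G.Adj s p ∧ G.Adj p w := by
  rcases Relation.ReflTransGen.cases_tail h with h | ⟨p, h, h'⟩
  · exact absurd h hw
  · exact ⟨p, h, h'⟩

/-- The label which the arc from `p` to `w` proposes for `w`. -/
def proposal {n : ℕ} (s : Fin n) (l : ℕ → ℕ) (p w : Fin n) : ℕ :=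
  open Classical in if p = s then (w : ℕ) + 1 else l p

/-- `l` assigns to every vertex `w` reachable from `s` the number `x + 1`, where `x` is the
child of `s` in the dominator tree below which `w` lies, and `0` to every other vertex. -/
structure IsLabeling {n : ℕ} (G : Digraph (Fin n)) (s : Fin n) (l : ℕ → ℕ) : Prop where
  root : l s = s + 1
  ne_zero_iff : ∀ w : Fin n, l w ≠ 0 ↔ Relation.ReflTransGen G.Adj s w
  step : ∀ w : Fin n, Relation.ReflTransGen G.Adj s w → w ≠ s →
    (∀ p, Relation.ReflTransGen G.Adj s p → G.Adj p w → proposal s l p w = l w) ∨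
    (l w = w + 1 ∧ ∃ p q, Relation.ReflTransGen G.Adj s p ∧ G.Adj p w ∧
      Relation.ReflTransGen G.Adj s q ∧ G.Adj q w ∧ proposal s l p w ≠ proposal s l q w)

variable {n : ℕ} {G : Digraph (Fin n)} {s : Fin n} {l : ℕ → ℕ}

/-- The label of `w` names a vertex other than `s` which lies on every path from `s` to `w`. -/
theorem IsLabeling.dominates (hl : IsLabeling G s l)
    {w : Fin n} {P : List (Fin n)} (hP : IsDirPath G s w P) (hw : w ≠ s) :
    ∃ x ∈ P, x ≠ s ∧ l w = (x : ℕ) + 1 := by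
  induction P using List.reverseRecOn generalizing w with
  | nil => simpa using hP.end_mem
  | append_singleton P' a ih =>
    obtain ⟨p, P'', h, hP', hp⟩ := hP.exists_pred hw
    obtain ⟨rfl, rfl⟩ : P' = P'' ∧ a = w := by simpa using List.append_inj' h rfl
    -- Either the label is inherited along the last arc of the path, or the label names `w` itself.
    rcases hl.step _ hP.reach hw with h | ⟨h, -⟩
    · have h := h p hP'.reach hp
      by_cases hps : p = s
      · exact ⟨a, by simp, hw, by rw [← h, proposal, if_pos hps]⟩
      · obtain ⟨x, hx, hxs, hlx⟩ := ih hP' hps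
        exact ⟨x, by simp [hx], hxs, by rw [← h, proposal, if_neg hps, hlx]⟩
    · exact ⟨a, by simp, hw, h⟩

/-- By `IsLabeling.dominates`, the label of any other reachable vertex names a vertex different from
`s`. -/
theorem IsLabeling.eq_root_iff (hl : IsLabeling G s l) (hG : IsDAG G) {w : Fin n} :
    l w = s + 1 ↔ w = s := by
  refine ⟨fun h => ?_, fun h => h ▸ hl.root⟩
  by_contra hw
  obtain ⟨P, hP⟩ := exists_isDirPath hG ((hl.ne_zero_iff w).1 (by omega))
  obtain ⟨x, -, hxs, hx⟩ := hl.dominates hP hw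
  exact hxs (Fin.ext (by omega))

/-- Induction on the sum of the ranks. The endpoint of larger rank, say `v`, is replaced by a
predecessor `p` whose label still differs from that of `u`. Appending `v` to the path to `p` is
harmless, because the path to `u` contains no vertex other than `u` of rank at least that of `u`. -/
theorem IsLabeling.exists_paths (hl : IsLabeling G s l) (hG : IsDAG G) {u v : Fin n}
    (hu : Relation.ReflTransGen G.Adj s u) (hv : Relation.ReflTransGen G.Adj s v)
    (huv : l u ≠ l v) :
    ∃ P Q, IsDirPath G s u P ∧ IsDirPath G s v Q ∧ ∀ x, x ∈ P → x ∈ Q → x = s := by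
  obtain ⟨r, hr⟩ := hG.exists_rank
  induction hN : r u + r v using Nat.strong_induction_on generalizing u v with
  | _ N ih =>
  wlog hle : r u ≤ r v generalizing u v
  · obtain ⟨Q, P, hQ, hP, h⟩ := this hv hu huv.symm (by omega) (by omega)
    exact ⟨P, Q, hP, hQ, fun x hx hx' => h x hx' hx⟩
  have hne : u ≠ v := by rintro rfl; exact huv rfl
  by_cases hus : u = s
  · obtain ⟨Q, hQ⟩ := exists_isDirPath hG hv
    subst hus
    exact ⟨[u], Q, isDirPath_singleton u, hQ, by simp⟩
  have hvs : v ≠ s := by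
    rintro rfl
    obtain ⟨p, hp, hpu⟩ := exists_pred_of_reach hu hus
    have := rank_le_of_reach hr hp
    have := hr _ _ hpu
    omega
  obtain ⟨p, hp, hpv, hlp⟩ :
      ∃ p, Relation.ReflTransGen G.Adj s p ∧ G.Adj p v ∧ l u ≠ l p := by
    -- The arc from `s` proposes `v + 1` and not the label of `s`; but the label of `s` differs from
    -- that of `u` anyway, as `u ≠ s`.
    have key : ∀ p, l u ≠ proposal s l p v → l u ≠ l p := by
      intro p h
      by_cases hps : p = s
      · rw [hps, hl.root]
        exact fun h => hus ((hl.eq_root_iff hG).1 h)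
      · rwa [proposal, if_neg hps] at h
    -- If the proposals for `v` agree, any predecessor will do; of two different proposals, at least
    -- one differs from `l u`.
    rcases hl.step v hv hvs with h | ⟨-, p, q, hp, hpv, hq, hqv, hpq⟩
    · obtain ⟨p, hp, hpv⟩ := exists_pred_of_reach hv hvs
      exact ⟨p, hp, hpv, key p (by rwa [h p hp hpv])⟩
    · by_cases h : l u = proposal s l p v
      · exact ⟨q, hq, hqv, key q (by rwa [h])⟩
      · exact ⟨p, hp, hpv, key p h⟩
  obtain ⟨P, Q, hP, hQ, h⟩ := ih (r u + r p) (by have := hr _ _ hpv; omega) hu hp hlp rfl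
  refine ⟨P, Q ++ [v], hP, hQ.concat hG hpv, fun x hx hx' => ?_⟩
  rcases List.mem_append.1 hx' with hx' | hx'
  · exact h x hx hx'
  · obtain rfl := List.mem_singleton.1 hx'
    -- If `v` were on `P`, it would precede `u` and so have smaller rank, against `r u ≤ r v`.
    rcases Relation.ReflTransGen.cases_tail (hP.reach_of_mem hx).2 with h | ⟨q, hq, hqu⟩
    · exact absurd h hne
    · have := rank_le_of_reach hr hq
      have := hr _ _ hqu
      omega

theorem IsLabeling.isJunction_iff (hl : IsLabeling G s l) (hG : IsDAG G) {u v : Fin n} :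
    IsJunction G s u v ↔ l u ≠ 0 ∧ l v ≠ 0 ∧ l u ≠ l v := by
  rw [hl.ne_zero_iff, hl.ne_zero_iff]
  constructor
  · rintro ⟨huv, P, Q, hP, hQ, h⟩
    refine ⟨hP.reach, hQ.reach, fun hlab => huv ?_⟩
    by_cases hus : u = s
    · rw [hus, hl.root] at hlab
      rw [hus, (hl.eq_root_iff hG).1 hlab.symm]
    by_cases hvs : v = s
    · rw [hvs, hl.root] at hlab
      rw [hvs, (hl.eq_root_iff hG).1 hlab]
    obtain ⟨x, hxP, hxs, hx⟩ := hl.dominates hP hus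
    obtain ⟨y, hyQ, -, hy⟩ := hl.dominates hQ hvs
    -- Equal labels name one vertex, which is common to both paths and not `s`; so it must be the
    -- last vertex of both.
    obtain rfl : x = y := Fin.ext (by omega)
    obtain ⟨h1, h2⟩ := h x hxP hyQ
    simp only [IsEnd, hP.2.2.1, hP.2.2.2, hQ.2.2.1, hQ.2.2.2, Option.some.injEq] at h1 h2
    rw [h1.resolve_left (Ne.symm hxs), h2.resolve_left (Ne.symm hxs)]
  · rintro ⟨hu, hv, huv⟩
    obtain ⟨P, Q, hP, hQ, h⟩ := hl.exists_paths hG hu hv huv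
    refine ⟨by rintro rfl; exact huv rfl, P, Q, hP, hQ, fun x hx hx' => ?_⟩
    obtain rfl := h x hx hx'
    exact ⟨Or.inl hP.2.2.1, Or.inl hQ.2.2.1⟩

end Graph

/-- Started in `σ`, the program `p` halts after at most `B` steps in a state satisfying `Q`. -/
def HaltsWithin (p : Program) (σ : State) (B : ℕ) (Q : State → Prop) : Prop :=
  ∃ σ' t, Runs p σ σ' t ∧ t ≤ B ∧ Q σ'

theorem HaltsWithin.mono {p : Program} {σ : State} {B B' : ℕ} {Q Q' : State → Prop}
    (h : HaltsWithin p σ B Q) (hB : B ≤ B') (hQ : ∀ σ', Q σ' → Q' σ') :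
    HaltsWithin p σ B' Q' := by
  obtain ⟨σ', t, hr, ht, hq⟩ := h
  exact ⟨σ', t, hr, ht.trans hB, hQ _ hq⟩

theorem HaltsWithin.seq {p q : Program} {σ : State} {B₁ B₂ : ℕ} {R Q : State → Prop}
    (h : HaltsWithin p σ B₁ R) (h' : ∀ σ', R σ' → HaltsWithin q σ' B₂ Q) :
    HaltsWithin (.seq p q) σ (B₁ + B₂) Q := by
  obtain ⟨σ₁, t₁, hr₁, ht₁, hR⟩ := h
  obtain ⟨σ₂, t₂, hr₂, ht₂, hQ⟩ := h' σ₁ hR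
  exact ⟨σ₂, _, hr₁.seq hr₂, Nat.add_le_add ht₁ ht₂, hQ⟩

/-- The weakest precondition of a loop-free program. -/
def wp : Program → (State → Prop) → State → Prop
  | .skip, Q, σ => Q σ
  | .op o, Q, σ => Q (o.apply σ)
  | .seq p q, Q, σ => wp p (wp q Q) σ
  | .ite b p q, Q, σ => (b.Holds σ → wp p Q σ) ∧ (¬ b.Holds σ → wp q Q σ)
  | .loop _ _, _, _ => False

/-- A bound for the running time of a loop-free program. -/
def cost : Program → ℕ
  | .skip => 1
  | .op _ => 1
  | .seq p q => cost p + cost q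
  | .ite _ p q => max (cost p) (cost q) + 1
  | .loop _ _ => 0

theorem haltsWithin_of_wp {p : Program} {σ : State} {Q : State → Prop} (h : wp p Q σ) :
    HaltsWithin p σ (cost p) Q := by
  induction p generalizing σ Q with
  | skip => exact ⟨σ, 1, .skip σ, le_rfl, h⟩
  | op o => exact ⟨_, 1, .op o σ, le_rfl, h⟩
  | seq p q ihp ihq => exact (ihp h).seq fun σ' h' => ihq h'
  | ite b p q ihp ihq =>
    by_cases hb : b.Holds σ
    · obtain ⟨σ', t, hr, ht, hq⟩ := ihp (h.1 hb)
      exact ⟨σ', _, .iteTrue hb hr, by simp only [cost]; omega, hq⟩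
    · obtain ⟨σ', t, hr, ht, hq⟩ := ihq (h.2 hb)
      exact ⟨σ', _, .iteFalse hb hr, by simp only [cost]; omega, hq⟩
  -- Since `wp` is `False` on loops, the value `0` of `cost` there is never used as a bound.
  | loop b p => exact h.elim

/-- The rule for loops, with a potential `φ` that pays for the steps. -/
theorem HaltsWithin.loop {b : Test} {p : Program} (I : ℕ → State → Prop)
    (h : ∀ φ σ, I φ σ → b.Holds σ →
      ∃ B, HaltsWithin p σ B fun σ' => ∃ φ', B + 1 + φ' ≤ φ ∧ I φ' σ')
    {φ : ℕ} {σ : State} (h0 : I φ σ) :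
    HaltsWithin (.loop b p) σ (φ + 1) fun σ' => (∃ φ', I φ' σ') ∧ ¬ b.Holds σ' := by
  induction φ using Nat.strong_induction_on generalizing σ with
  | _ φ ih =>
  by_cases hb : b.Holds σ
  · obtain ⟨B, σ₁, t₁, hr₁, ht₁, φ', hφ, hI⟩ := h φ σ h0 hb
    obtain ⟨σ₂, t₂, hr₂, ht₂, hq⟩ := ih φ' (by omega) hI
    exact ⟨σ₂, _, .loopTrue hb hr₁ hr₂, by omega, hq⟩
  · exact ⟨σ, 1, .loopFalse hb, by omega, ⟨φ, h0⟩, hb⟩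

/-- The rule for loops with `N` passes, each of them taking at most `B` steps. -/
theorem HaltsWithin.for {b : Test} {p : Program} (I : ℕ → State → Prop) (N B : ℕ)
    (hb : ∀ j σ, I j σ → (b.Holds σ ↔ j < N))
    (h : ∀ j σ, I j σ → j < N → HaltsWithin p σ B (I (j + 1)))
    {σ : State} (h0 : I 0 σ) :
    HaltsWithin (.loop b p) σ ((B + 1) * N + 1) (I N) := by
  have key : ∀ d j σ, j + d = N → I j σ → HaltsWithin (.loop b p) σ ((B + 1) * d + 1) (I N) := by
    intro d
    induction d with
    | zero =>
      intro j σ hj hI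
      obtain rfl : j = N := by omega
      exact ⟨σ, 1, .loopFalse (by rw [hb j σ hI]; omega), by omega, hI⟩
    | succ d ih =>
      intro j σ hj hI
      obtain ⟨σ₁, t₁, hr₁, ht₁, hI₁⟩ := h j σ hI (by omega)
      obtain ⟨σ₂, t₂, hr₂, ht₂, hq⟩ := ih (j + 1) σ₁ (by omega) hI₁
      refine ⟨σ₂, _, .loopTrue ((hb j σ hI).2 (by omega)) hr₁ hr₂, ?_, hq⟩
      rw [Nat.mul_succ]; omega
  exact key N 0 σ (by omega) h0

/-- The sequence of a nonempty list of programs. -/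
def block : List Program → Program
  | [] => .skip
  | [p] => p
  | p :: q :: l => .seq p (block (q :: l))

theorem State.reg_setReg (σ : State) (x a y : ℕ) :
    (σ.setReg x a).reg y = if y = x then a else σ.reg y := by
  simp [State.setReg, Function.update_apply]

theorem State.arr_setReg (σ : State) (x a : ℕ) : (σ.setReg x a).arr = σ.arr := rfl

theorem State.reg_setArr (σ : State) (A i a : ℕ) : (σ.setArr A i a).reg = σ.reg := rfl

theorem State.arr_setArr (σ : State) (A i a B : ℕ) :
    (σ.setArr A i a).arr B = if B = A then Function.update (σ.arr A) i a else σ.arr B := by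
  simp [State.setArr, Function.update_apply]

/-! ### Memory layout and queue traversal of the reachable part. -/

/-- The registers `0` to `4` and the arrays `0` to `6` have the same contents. -/
def Frame (σ₀ σ : State) : Prop :=
  (∀ x < 5, σ.reg x = σ₀.reg x) ∧ ∀ A < 7, σ.arr A = σ₀.arr A

theorem Frame.refl (σ : State) : Frame σ σ := ⟨fun _ _ => rfl, fun _ _ => rfl⟩

/-- Working data lie outside the frame: the higher registers, array `7` (in-degree counters), array
`8` (labels) and array `9` (queue). The frame protects the input, the current vertex `s` in register
`3`, the constant zero in register `4` and the output arrays `4` to `6`. -/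
theorem frame_setReg {σ₀ σ : State} {x a : ℕ} (hx : 5 ≤ x) :
    Frame σ₀ (σ.setReg x a) ↔ Frame σ₀ σ := by
  refine and_congr (forall₂_congr fun y hy => ?_) Iff.rfl
  rw [State.reg_setReg, if_neg (by omega)]

theorem frame_setArr {σ₀ σ : State} {A i a : ℕ} (hA : 7 ≤ A) :
    Frame σ₀ (σ.setArr A i a) ↔ Frame σ₀ σ := by
  refine and_congr Iff.rfl (forall₂_congr fun y hy => ?_)
  rw [State.arr_setArr, if_neg (by omega)]

/-- The arrays `a₀` and `a₁` hold the adjacency lists `adj`. -/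
def HoldsAdjLists {n : ℕ} (adj : Fin n → List (Fin n)) (a₀ a₁ : ℕ → ℕ) : Prop :=
  ∀ u : Fin n, a₀ (u + 1) = a₀ u + (adj u).length ∧
    ∀ (j : ℕ) (hj : j < (adj u).length), a₁ (a₀ u + j) = (adj u)[j]

/-- Array `9` holds the list `L`, and register `6` holds its length. -/
structure HoldsQueue {n : ℕ} (L : List (Fin n)) (σ : State) : Prop where
  length : σ.reg 6 = L.length
  get : ∀ (i : ℕ) (hi : i < L.length), σ.arr 9 i = L[i]

theorem HoldsQueue.of_eq {n : ℕ} {L : List (Fin n)} {σ σ' : State} (h : HoldsQueue L σ)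
    (h6 : σ'.reg 6 = σ.reg 6) (h9 : σ'.arr 9 = σ.arr 9) : HoldsQueue L σ' :=
  ⟨h6.trans h.length, fun i hi => by rw [h9, h.get i hi]⟩

theorem HoldsQueue.push {n : ℕ} {L : List (Fin n)} {σ σ' : State} (h : HoldsQueue L σ)
    {c : Fin n} (h6 : σ'.reg 6 = σ.reg 6 + 1)
    (h9 : σ'.arr 9 = Function.update (σ.arr 9) (σ.reg 6) c) : HoldsQueue (L ++ [c]) σ' := by
  refine ⟨by rw [h6, h.length, List.length_append]; rfl, fun i hi => ?_⟩
  rw [h9, h.length, Function.update_apply, List.getElem_append]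
  split_ifs with h1 h2 h2
  · omega
  · simp
  · exact h.get i h2
  · simp at hi; omega

theorem card_le_arcCount {n : ℕ} {G : Digraph (Fin n)} {A : Finset (Fin n × Fin n)}
    (hA : ∀ p c, (p, c) ∈ A → G.Adj p c) : A.card ≤ arcCount G := by
  rw [arcCount, ← Set.ncard_coe_finset]
  exact Set.ncard_le_ncard (fun e he => hA e.1 e.2 he) (Set.toFinite _)

/-- Starting with the vertex in register `3`, process the vertices of a queue in array `9`
(positions from register `5` to register `6`) one by one. For each of them (register `7`), execute
`body` for every child (register `10`). -/
def traverse (body : Program) : Program :=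
  .seq (block [.op (.const 5 0), .op (.store 9 5 3), .op (.const 6 1)])
  (.loop (.lt 5 6)
    (.seq (block [.op (.load 7 9 5), .op (.load 8 0 7), .op (.copy 11 7), .op (.inc 11),
      .op (.load 9 0 11)])
    (.seq (.loop (.lt 8 9) (.seq (.op (.load 10 1 8)) (.seq body (.op (.inc 8)))))
      (.op (.inc 5)))))

/-- When `body` is executed for an arc `(w, c)`, it may extend the queue, and the invariant `X` of
the set of processed arcs, the queue and the arrays `7` and `8` is preserved. -/
def ArcSpec {n : ℕ} (adj : Fin n → List (Fin n)) (σ₀ : State)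
    (X : Finset (Fin n × Fin n) → List (Fin n) → (ℕ → ℕ) → (ℕ → ℕ) → Prop)
    (body : Program) (B : ℕ) : Prop :=
  ∀ (A : Finset (Fin n × Fin n)) (L : List (Fin n)) (σ : State) (w c : Fin n),
    Frame σ₀ σ → HoldsQueue L σ → σ.reg 7 = w → σ.reg 10 = c → w ∈ L → c ∈ adj w →
    (w, c) ∉ A → X A L (σ.arr 7) (σ.arr 8) →
    HaltsWithin body σ B fun σ' => Frame σ₀ σ' ∧ σ'.reg 5 = σ.reg 5 ∧ σ'.reg 7 = σ.reg 7 ∧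
      σ'.reg 8 = σ.reg 8 ∧ σ'.reg 9 = σ.reg 9 ∧
      ∃ L', L <+: L' ∧ HoldsQueue L' σ' ∧ X (insert (w, c) A) L' (σ'.arr 7) (σ'.arr 8)

/-- Shared by counting and labelling, which differ only in `body` and `X`. The queue exceeds the
number of processed arcs by at most one, so at most `m + 1` vertices are handled and the bound is
free of `n`. When the queue is exhausted, the processed arcs are exactly those leaving its vertices.
-/
theorem traverse_spec {n : ℕ} {G : Digraph (Fin n)} {adj : Fin n → List (Fin n)} {s : Fin n}
    (hadj : IsAdjLists G adj) {σ₀ : State} (hin : HoldsAdjLists adj (σ₀.arr 0) (σ₀.arr 1))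
    (hs : σ₀.reg 3 = s)
    {X : Finset (Fin n × Fin n) → List (Fin n) → (ℕ → ℕ) → (ℕ → ℕ) → Prop}
    (hX : ∀ A L D l, X A L D l → L.Nodup ∧ L.length ≤ A.card + 1)
    {body : Program} {B : ℕ} (hbody : ArcSpec adj σ₀ X body B)
    {σ : State} (hσ : Frame σ₀ σ) (h0 : X ∅ [s] (σ.arr 7) (σ.arr 8)) :
    HaltsWithin (traverse body) σ ((B + 20) * (arcCount G + 1)) fun σ' => Frame σ₀ σ' ∧
      ∃ A L, HoldsQueue L σ' ∧ (∀ p c, (p, c) ∈ A ↔ p ∈ L ∧ G.Adj p c) ∧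
        X A L (σ'.arr 7) (σ'.arr 8) := by
  have hcard : ∀ {A : Finset (Fin n × Fin n)} {S : List (Fin n)},
      (∀ p c, (p, c) ∈ A ↔ p ∈ S ∧ G.Adj p c) → A.card ≤ arcCount G :=
    fun h => card_le_arcCount fun p c hpc => ((h p c).1 hpc).2
  -- `S` is the part of the queue already handled. Each remaining arc is paid `B + 3` (body, load,
  -- increment, test), each remaining vertex `8` (five loads and copies, the failing inner test, the
  -- increment, the outer test).
  let I : ℕ → State → Prop := fun φ σ => ∃ S A L, Frame σ₀ σ ∧ HoldsQueue L σ ∧ S <+: L ∧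
    σ.reg 5 = S.length ∧ (∀ p c, (p, c) ∈ A ↔ p ∈ S ∧ G.Adj p c) ∧ X A L (σ.arr 7) (σ.arr 8) ∧
    φ = (B + 3) * (arcCount G - A.card) + 8 * (arcCount G + 1 - S.length)
  have main : ∀ {φ : ℕ} {σ : State}, I φ σ → HaltsWithin _ σ (φ + 1) _ :=
    HaltsWithin.loop (b := .lt 5 6)
    (p := .seq (block [.op (.load 7 9 5), .op (.load 8 0 7), .op (.copy 11 7), .op (.inc 11),
      .op (.load 9 0 11)])
      (.seq (.loop (.lt 8 9) (.seq (.op (.load 10 1 8)) (.seq body (.op (.inc 8)))))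
      (.op (.inc 5)))) I (by
    rintro φ σ ⟨S, A, L, hF, hQ, hpre, h5, hA, hXA, hφ⟩ hb
    obtain ⟨R, rfl⟩ := hpre
    simp only [Test.Holds, h5, hQ.length] at hb
    obtain _ | ⟨w, R⟩ := R
    · simp at hb
    have hnd := (hX _ _ _ _ hXA).1
    have hlen := (hX _ _ _ _ hXA).2
    have hwS : w ∉ S := fun h => (List.nodup_append.1 hnd).2.2 w h w (by simp) rfl
    have hAm := hcard hA
    simp only [List.length_append, List.length_cons] at hlen
    -- The first `j` children of `w` have been handled; `w` is not in `S`, so all its arcs are new.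
    let J : ℕ → State → Prop := fun j τ => ∃ A' L', Frame σ₀ τ ∧ HoldsQueue L' τ ∧
      S ++ [w] <+: L' ∧ τ.reg 5 = S.length ∧ τ.reg 7 = w ∧ τ.reg 8 = σ₀.arr 0 w + j ∧
      τ.reg 9 = σ₀.arr 0 w + (adj w).length ∧
      (∀ p c, (p, c) ∈ A' ↔ (p ∈ S ∧ G.Adj p c) ∨ (p = w ∧ c ∈ (adj w).take j)) ∧
      A'.card = A.card + j ∧ X A' L' (τ.arr 7) (τ.arr 8)
    refine ⟨cost (block [.op (.load 7 9 5), .op (.load 8 0 7), .op (.copy 11 7), .op (.inc 11),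
      .op (.load 9 0 11)]) + (((B + 2 + 1) * (adj w).length + 1) + 1),
      HaltsWithin.seq (R := J 0) (haltsWithin_of_wp ?_) fun σ₁ hσ₁ => HaltsWithin.seq
        (HaltsWithin.for J (adj w).length (B + 2) ?_ ?_ hσ₁) fun σ₂ hσ₂ =>
        haltsWithin_of_wp (p := .op (.inc 5)) ?_⟩
    · have hw : σ.arr 9 S.length = w := by
        rw [hQ.get _ (by simp)]; simp
      simp only [wp, block, Op.apply, J, State.reg_setReg, State.arr_setReg, h5, hw]
      refine ⟨A, S ++ w :: R, by simpa [frame_setReg] using hF, hQ.of_eq rfl rfl, ⟨R, by simp⟩,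
        ?_, ?_, ?_, ?_, by simpa using hA, by simp, hXA⟩
      · simp
      · simp
      · simp [hF.2]
      · simp [hF.2, (hin w).1]
    · rintro j τ ⟨A', L', -, -, -, -, -, h8, h9, -⟩
      simp only [Test.Holds, h8, h9]; omega
    · rintro j τ ⟨A', L', hF', hQ', hpre', h5', h7', h8', h9', hA', hc', hX'⟩ hj
      have hwL : w ∈ L' := hpre'.subset (by simp)
      have hmem : (adj w)[j] ∈ adj w := List.getElem_mem hj
      have hnm : (adj w)[j] ∉ (adj w).take j := by
        intro h
        obtain ⟨i, hi, he⟩ := List.mem_take_iff_getElem.1 h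
        have := ((hadj w).1.getElem_inj_iff).1 he
        omega
      have hnew : (w, (adj w)[j]) ∉ A' := by
        rw [hA']
        rintro (⟨h, -⟩ | ⟨-, h⟩)
        · exact hwS h
        · exact hnm h
      have hc : τ.arr 1 (τ.reg 8) = (adj w)[j] := by
        rw [hF'.2 1 (by norm_num), h8', (hin w).2 j hj]
      refine (HaltsWithin.seq (B₁ := 1) (R := fun τ' => τ' = τ.setReg 10 (adj w)[j])
        (haltsWithin_of_wp (p := .op (.load 10 1 8)) ?_) fun τ' hτ' =>
        HaltsWithin.seq (B₂ := 1) (hbody A' L' τ' w (adj w)[j] ?_ ?_ ?_ ?_ hwL hmem hnew ?_)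
          fun τ'' h'' => haltsWithin_of_wp (p := .op (.inc 8)) ?_).mono (by omega)
          fun _ h => h
      · simp only [wp, Op.apply, hc]
      · rw [hτ', frame_setReg (by norm_num)]; exact hF'
      · rw [hτ']; exact hQ'.of_eq rfl rfl
      · rw [hτ', State.reg_setReg]; simpa using h7'
      · rw [hτ', State.reg_setReg]; simp
      · rw [hτ']; exact hX'
      · obtain ⟨hF'', h5'', h7'', h8'', h9'', L'', hpre'', hQ'', hX''⟩ := h''
        simp only [wp, Op.apply]
        refine ⟨insert (w, (adj w)[j]) A', L'', by simpa [frame_setReg] using hF'',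
          hQ''.of_eq rfl rfl, hpre'.trans hpre'', ?_, ?_, ?_, ?_, fun p c => ?_, ?_, hX''⟩
        · simp [State.reg_setReg, h5'', hτ', h5']
        · simp [State.reg_setReg, h7'', hτ', h7']
        · simp [State.reg_setReg, h8'', hτ', h8']; omega
        · simp [State.reg_setReg, h9'', hτ', h9']
        · rw [Finset.mem_insert, hA', List.take_succ_eq_append_getElem hj, List.mem_append,
            List.mem_singleton, Prod.mk.injEq]
          tauto
        · rw [Finset.card_insert_of_notMem hnew, hc']; omega
    · obtain ⟨A', L', hF', hQ', hpre', h5', h7', h8', h9', hA', hc', hX'⟩ := hσ₂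
      have hA'' : ∀ p c, (p, c) ∈ A' ↔ p ∈ S ++ [w] ∧ G.Adj p c := by
        intro p c
        rw [hA', List.take_length, (hadj w).2, List.mem_append, List.mem_singleton]
        constructor
        · rintro (h | ⟨rfl, h⟩) <;> tauto
        · rintro ⟨h | rfl, h⟩ <;> tauto
      have hm' := hcard hA''
      refine ⟨_, ?_, S ++ [w], A', L', by simpa [Op.apply, frame_setReg] using hF',
        hQ'.of_eq rfl rfl, hpre', by simp [Op.apply, State.reg_setReg, h5'], hA'', hX', rfl⟩
      have hmul : (B + 3) * (arcCount G - A.card) =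
          (B + 3) * (adj w).length + (B + 3) * (arcCount G - A'.card) := by
        rw [← Nat.mul_add]; congr 1; omega
      simp only [cost, block, List.length_append, List.length_singleton]
      rw [hφ, hmul]
      simp only [show B + 2 + 1 = B + 3 from rfl]
      omega)
  refine (HaltsWithin.seq (haltsWithin_of_wp
    (p := block [.op (.const 5 0), .op (.store 9 5 3), .op (.const 6 1)])
    (Q := I ((B + 3) * arcCount G + 8 * (arcCount G + 1))) ?_) fun σ' hσ' =>
    main hσ').mono ?_ ?_
  · simp only [wp, block, Op.apply, State.reg_setReg]
    refine ⟨[], ∅, [s], by simpa [frame_setReg, frame_setArr] using hσ, ⟨?_, ?_⟩,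
      List.nil_prefix, ?_, by simp, ?_, by simp⟩
    · simp [State.reg_setReg]
    · simp [State.arr_setReg, State.arr_setArr, hσ.1, hs]
    · simp [State.reg_setReg, State.reg_setArr]
    · simpa [State.arr_setReg, State.arr_setArr] using h0
  · simp only [cost, block]
    nlinarith
  · rintro σ' ⟨⟨φ, S, A, L, hF, hQ, hpre, h5, hA, hXA, -⟩, hb⟩
    refine ⟨hF, A, L, hQ, ?_, hXA⟩
    simp only [Test.Holds, h5, hQ.length, not_lt] at hb
    obtain rfl := hpre.eq_of_length_le hb
    exact hA

/-! ### Invariants of in-degree counting and of label propagation. -/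

/-- The invariant of the computation of the in-degrees: `D` counts the arcs of `A`, and `L` lists
`s` and the heads of the arcs of `A`. -/
structure InDegreeInv {n : ℕ} (G : Digraph (Fin n)) (s : Fin n) (l₀ : ℕ → ℕ)
    (A : Finset (Fin n × Fin n)) (L : List (Fin n)) (D l : ℕ → ℕ) : Prop where
  nodup : L.Nodup
  length_le : L.length ≤ A.card + 1
  mem_iff : ∀ c, c ∈ L ↔ c = s ∨ ∃ p, (p, c) ∈ A
  reach : ∀ c ∈ L, Relation.ReflTransGen G.Adj s c
  deg : ∀ c : Fin n, D c = Set.ncard {p | (p, c) ∈ A}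
  lab : l = l₀

/-- The counter doubles as a visited mark: by acyclicity `c ≠ s`, and any other vertex is in the
queue exactly when an arc into it has been counted. -/
theorem InDegreeInv.insert_arc {n : ℕ} {G : Digraph (Fin n)} (hG : IsDAG G) {s : Fin n} {l₀ : ℕ → ℕ}
    {A : Finset (Fin n × Fin n)} {L : List (Fin n)} {D l : ℕ → ℕ}
    (h : InDegreeInv G s l₀ A L D l) {w c : Fin n} (hw : w ∈ L) (hwc : G.Adj w c)
    (hA : (w, c) ∉ A) :
    InDegreeInv G s l₀ (insert (w, c) A) (if D c = 0 then L ++ [c] else L)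
      (Function.update D c (D c + 1)) l := by
  have hcs : c ≠ s := by
    rintro rfl
    exact hG.irrefl_of_reach (h.reach w hw) hwc
  have h0 : D c = 0 ↔ c ∉ L := by
    rw [h.deg, Set.ncard_eq_zero (Set.toFinite _), h.mem_iff, Set.eq_empty_iff_forall_notMem]
    simp [hcs]
  have hmem : ∀ x, x ∈ (if D c = 0 then L ++ [c] else L) ↔ x ∈ L ∨ x = c := by
    intro x
    split_ifs with hD
    · simp
    · have : c ∈ L := by simpa using mt h0.2 hD
      constructor
      · exact Or.inl
      · rintro (hx | rfl) <;> assumption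
  refine ⟨?_, ?_, fun x => ?_, fun x hx => ?_, fun x => ?_, h.lab⟩
  · split_ifs with hD
    · exact List.nodup_append.2 ⟨h.nodup, by simp, by
        intro a ha b hb; rw [List.mem_singleton.1 hb]; rintro rfl; exact h0.1 hD ha⟩
    · exact h.nodup
  · rw [Finset.card_insert_of_notMem hA]
    have := h.length_le
    split_ifs
    · simp; omega
    · omega
  · rw [hmem, h.mem_iff]
    simp only [Finset.mem_insert, Prod.mk.injEq]
    constructor
    · rintro ((hx | ⟨p, hp⟩) | rfl)
      · exact Or.inl hx
      · exact Or.inr ⟨p, Or.inr hp⟩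
      · exact Or.inr ⟨w, Or.inl ⟨rfl, rfl⟩⟩
    · rintro (hx | ⟨p, ⟨-, hp⟩ | hp⟩)
      · exact Or.inl (Or.inl hx)
      · exact Or.inr hp
      · exact Or.inl (Or.inr ⟨p, hp⟩)
  · rcases (hmem x).1 hx with hx | rfl
    · exact h.reach x hx
    · exact (h.reach w hw).tail hwc
  · by_cases hx : x = c
    · subst hx
      have : {p | (p, x) ∈ insert (w, x) A} = insert w {p | (p, x) ∈ A} := by
        ext p; simp
      rw [this, Set.ncard_insert_of_notMem (a := w) (s := {p | (p, x) ∈ A}) hA, ← h.deg, Function.update_self]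
    · have : {p | (p, x) ∈ insert (w, c) A} = {p | (p, x) ∈ A} := by
        ext p; simp [hx]
      rw [this, ← h.deg, Function.update_of_ne (by simpa [Fin.val_inj] using hx)]

/-- The label of a vertex `c` with label `x` after the proposal `y`. -/
def updatedLabel (c x y : ℕ) : ℕ :=
  if x = 0 then y else if x = y then x else c + 1

/-- The invariant of the computation of the labels, with processed arcs `A`: `D` counts the arcs
not in `A`, the queue `M` lists the vertices whose entering arcs are all in `A`, and the labels are
the result of the proposals of the arcs in `A`. -/
structure LabelInv {n : ℕ} (G : Digraph (Fin n)) (s : Fin n)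
    (A : Finset (Fin n × Fin n)) (M : List (Fin n)) (D l : ℕ → ℕ) : Prop where
  nodup : M.Nodup
  length_le : M.length ≤ A.card + 1
  mem_iff : ∀ c, c ∈ M ↔ Relation.ReflTransGen G.Adj s c ∧
    ∀ p, Relation.ReflTransGen G.Adj s p → G.Adj p c → (p, c) ∈ A
  source_mem : ∀ p c, (p, c) ∈ A → p ∈ M
  deg : ∀ c : Fin n,
    D c = Set.ncard {p | Relation.ReflTransGen G.Adj s p ∧ G.Adj p c ∧ (p, c) ∉ A}
  root : l s = s + 1
  lab_zero : ∀ c : Fin n, c ≠ s → (∀ p, (p, c) ∉ A) → l c = 0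
  lab_step : ∀ c : Fin n, c ≠ s → (∃ p, (p, c) ∈ A) → l c ≠ 0 ∧
    ((∀ p, (p, c) ∈ A → proposal s l p c = l c) ∨
      (l c = c + 1 ∧ ∃ p q, (p, c) ∈ A ∧ (q, c) ∈ A ∧ proposal s l p c ≠ proposal s l q c))

/-- A vertex is queued only when all arcs into it from reachable vertices are processed, so labels
of queued vertices are final. As `(w, c)` is new, `c` is not queued, and changing its label affects
no proposal made so far. -/
theorem LabelInv.insert_arc {n : ℕ} {G : Digraph (Fin n)} (hG : IsDAG G) {s : Fin n}
    {A : Finset (Fin n × Fin n)} {M : List (Fin n)} {D l : ℕ → ℕ}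
    (h : LabelInv G s A M D l) {w c : Fin n} (hw : w ∈ M) (hwc : G.Adj w c)
    (hA : (w, c) ∉ A) :
    LabelInv G s (insert (w, c) A) (if D c - 1 = 0 then M ++ [c] else M)
      (Function.update D c (D c - 1))
      (Function.update l c (updatedLabel c (l c) (proposal s l w c))) := by
  have hws : Relation.ReflTransGen G.Adj s w := ((h.mem_iff w).1 hw).1
  have hcs : c ≠ s := by
    rintro rfl
    exact hG.irrefl_of_reach hws hwc
  have hcM : c ∉ M := fun hc => hA (((h.mem_iff c).1 hc).2 w hws hwc)
  set D' := Function.update D c (D c - 1) with hD'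
  have hdeg : ∀ x : Fin n, D' x = Set.ncard
      {p | Relation.ReflTransGen G.Adj s p ∧ G.Adj p x ∧ (p, x) ∉ insert (w, c) A} := by
    intro x
    by_cases hx : x = c
    · subst hx
      have : {p | Relation.ReflTransGen G.Adj s p ∧ G.Adj p x ∧ (p, x) ∉ insert (w, x) A} =
          {p | Relation.ReflTransGen G.Adj s p ∧ G.Adj p x ∧ (p, x) ∉ A} \ {w} := by
        ext p; simp; tauto
      have hmem : w ∈ {p | Relation.ReflTransGen G.Adj s p ∧ G.Adj p x ∧ (p, x) ∉ A} :=
        ⟨hws, hwc, hA⟩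
      rw [this, Set.ncard_sdiff_singleton_of_mem hmem, ← h.deg, hD',
        Function.update_self]
    · have : {p | Relation.ReflTransGen G.Adj s p ∧ G.Adj p x ∧ (p, x) ∉ insert (w, c) A} =
          {p | Relation.ReflTransGen G.Adj s p ∧ G.Adj p x ∧ (p, x) ∉ A} := by
        ext p; simp [hx]
      rw [this, ← h.deg, hD', Function.update_of_ne (by simpa [Fin.val_inj] using hx)]
  have h0 : D c - 1 = 0 ↔
      ∀ p, Relation.ReflTransGen G.Adj s p → G.Adj p c → (p, c) ∈ insert (w, c) A := by
    have := hdeg c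
    rw [hD', Function.update_self] at this
    rw [this, Set.ncard_eq_zero (Set.toFinite _), Set.eq_empty_iff_forall_notMem]
    simp only [Set.mem_ofPred_eq]
    exact forall_congr' fun p => by tauto
  have hmem : ∀ x, x ∈ (if D c - 1 = 0 then M ++ [c] else M) ↔ x ∈ M ∨ (x = c ∧ D c - 1 = 0) := by
    intro x
    split_ifs with hD <;> simp [hD]
  have hsrc : ∀ p x, (p, x) ∈ insert (w, c) A → p ∈ M := by
    intro p x hpx
    rw [Finset.mem_insert, Prod.mk.injEq] at hpx
    rcases hpx with ⟨rfl, -⟩ | hpx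
    · exact hw
    · exact h.source_mem p x hpx
  set l' := Function.update l c (updatedLabel c (l c) (proposal s l w c)) with hl'
  have hl'ne : ∀ x : Fin n, x ≠ c → l' x = l x := fun x hx => by
    rw [hl', Function.update_of_ne (by simpa [Fin.val_inj] using hx)]
  have hprop : ∀ p ∈ M, ∀ x, proposal s l' p x = proposal s l p x := by
    intro p hp x
    unfold proposal
    rw [hl'ne p (by rintro rfl; exact hcM hp)]
  -- Label `0` means that no proposal has arrived yet, so proposals must be nonzero; a queued `w ≠
  -- s` has received one.
  have hy : proposal s l w c ≠ 0 := by
    unfold proposal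
    split_ifs with hws'
    · omega
    · obtain ⟨p, hp, hpw⟩ := exists_pred_of_reach hws hws'
      exact (h.lab_step w hws' ⟨p, ((h.mem_iff w).1 hw).2 p hp hpw⟩).1
  refine ⟨?_, ?_, fun x => ?_, fun p x hpx => (hmem p).2 (Or.inl (hsrc p x hpx)), hdeg, ?_,
    fun x hx hx' => ?_, fun x hx hx' => ?_⟩
  · split_ifs with hD
    · exact List.nodup_append.2 ⟨h.nodup, by simp, by
        intro a ha b hb; rw [List.mem_singleton.1 hb]; rintro rfl; exact hcM ha⟩
    · exact h.nodup
  · rw [Finset.card_insert_of_notMem hA]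
    have := h.length_le
    split_ifs
    · simp; omega
    · omega
  · rw [hmem]
    by_cases hx : x = c
    · subst hx
      rw [h0]
      constructor
      · rintro (hx | ⟨-, hx⟩)
        · exact absurd hx hcM
        · exact ⟨hws.tail hwc, hx⟩
      · exact fun hx => Or.inr ⟨rfl, hx.2⟩
    · rw [h.mem_iff]
      simp [hx]
  · rw [hl'ne s hcs.symm, h.root]
  · have hxc : x ≠ c := by
      rintro rfl
      exact hx' w (Finset.mem_insert_self _ _)
    rw [hl'ne x hxc]
    exact h.lab_zero x hx fun p hp => hx' p (Finset.mem_insert_of_mem hp)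
  · by_cases hxc : x = c
    · subst hxc
      have hlx : l' x = updatedLabel x (l x) (proposal s l w x) := by
        rw [hl', Function.update_self]
      have hpw : proposal s l' w x = proposal s l w x := hprop w hw x
      by_cases hx0 : l x = 0
      · have hnone : ∀ p, (p, x) ∉ A := fun p hp => (h.lab_step x hcs ⟨p, hp⟩).1 hx0
        rw [updatedLabel, if_pos hx0] at hlx
        refine ⟨by rwa [hlx], Or.inl fun p hp => ?_⟩
        rw [Finset.mem_insert, Prod.mk.injEq] at hp
        rcases hp with ⟨rfl, -⟩ | hp
        · rw [hpw, hlx]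
        · exact absurd hp (hnone p)
      · have hsome : ∃ p, (p, x) ∈ A := by
          by_contra hn
          push Not at hn
          exact hx0 (h.lab_zero x hcs hn)
        rw [updatedLabel, if_neg hx0] at hlx
        refine ⟨by rw [hlx]; split_ifs <;> omega, ?_⟩
        rcases (h.lab_step x hcs hsome).2 with hall | ⟨hx1, p, q, hp, hq, hpq⟩
        · by_cases hyx : l x = proposal s l w x
          · rw [if_pos hyx] at hlx
            refine Or.inl fun p hp => ?_
            rw [hlx, hprop p (hsrc p x hp)]
            rw [Finset.mem_insert, Prod.mk.injEq] at hp
            rcases hp with ⟨rfl, -⟩ | hp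
            · exact hyx.symm
            · exact hall p hp
          · rw [if_neg hyx] at hlx
            obtain ⟨p, hp⟩ := hsome
            refine Or.inr ⟨hlx, p, w, Finset.mem_insert_of_mem hp, Finset.mem_insert_self _ _, ?_⟩
            rw [hprop p (h.source_mem p x hp), hpw, hall p hp]
            exact hyx
        -- After a conflict the label is `c + 1`, and every later proposal leaves it so, whether it
        -- agrees or not.
        · refine Or.inr ⟨?_, p, q, Finset.mem_insert_of_mem hp, Finset.mem_insert_of_mem hq, ?_⟩
          · rw [hlx]; split_ifs <;> simp [hx1]
          · rwa [hprop p (h.source_mem p x hp), hprop q (h.source_mem q x hq)]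
    · have hiff : ∀ p, (p, x) ∈ insert (w, c) A ↔ (p, x) ∈ A := by simp [hxc]
      simp only [hiff] at hx' ⊢
      rw [hl'ne x hxc]
      obtain ⟨h1, h2⟩ := h.lab_step x hx hx'
      refine ⟨h1, h2.imp (fun h2 p hp => ?_) ?_⟩
      · rw [hprop p (h.source_mem p x hp), h2 p hp]
      · rintro ⟨h2, p, q, hp, hq, hpq⟩
        refine ⟨h2, p, q, hp, hq, ?_⟩
        rwa [hprop p (h.source_mem p x hp), hprop q (h.source_mem q x hq)]

/-- The topological traversal cannot get stuck: by induction on rank, all reachable predecessors of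
`c` are queued, so all their arcs into `c` are processed. -/
theorem LabelInv.mem_of_reach {n : ℕ} {G : Digraph (Fin n)} (hG : IsDAG G) {s : Fin n}
    {A : Finset (Fin n × Fin n)} {M : List (Fin n)} {D l : ℕ → ℕ} (h : LabelInv G s A M D l)
    (hA : ∀ p c, (p, c) ∈ A ↔ p ∈ M ∧ G.Adj p c) {c : Fin n}
    (hc : Relation.ReflTransGen G.Adj s c) : c ∈ M := by
  obtain ⟨r, hr⟩ := hG.exists_rank
  induction hN : r c using Nat.strong_induction_on generalizing c with
  | _ N ih =>
  refine (h.mem_iff c).2 ⟨hc, fun p hp hpc => (hA p c).2 ⟨?_, hpc⟩⟩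
  exact ih (r p) (hN ▸ hr _ _ hpc) hp rfl

/-- At the end all arcs of the reachable part are processed, so the invariant becomes the definition
of a labelling. The counters being `0` again makes array `7` ready for the next start vertex. -/
theorem LabelInv.isLabeling {n : ℕ} {G : Digraph (Fin n)} (hG : IsDAG G) {s : Fin n}
    {A : Finset (Fin n × Fin n)} {M : List (Fin n)} {D l : ℕ → ℕ} (h : LabelInv G s A M D l)
    (hA : ∀ p c, (p, c) ∈ A ↔ p ∈ M ∧ G.Adj p c) :
    IsLabeling G s l ∧ ∀ c : Fin n, D c = 0 := by
  have hA' : ∀ p c, (p, c) ∈ A ↔ Relation.ReflTransGen G.Adj s p ∧ G.Adj p c := by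
    intro p c
    rw [hA]
    exact and_congr_left fun _ => ⟨fun hp => ((h.mem_iff p).1 hp).1, h.mem_of_reach hG hA⟩
  refine ⟨⟨h.root, fun w => ⟨fun hw => ?_, fun hw => ?_⟩, fun w hw hws => ?_⟩, fun c => ?_⟩
  · by_cases hws : w = s
    · rw [hws]
    by_contra hn
    exact hw (h.lab_zero w hws fun p hp => hn (((hA' p w).1 hp).1.tail ((hA' p w).1 hp).2))
  · by_cases hws : w = s
    · rw [hws, h.root]; omega
    obtain ⟨p, hp, hpw⟩ := exists_pred_of_reach hw hws
    exact (h.lab_step w hws ⟨p, (hA' p w).2 ⟨hp, hpw⟩⟩).1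
  · obtain ⟨p, hp, hpw⟩ := exists_pred_of_reach hw hws
    refine (h.lab_step w hws ⟨p, (hA' p w).2 ⟨hp, hpw⟩⟩).2.imp (fun h p hp hpw => ?_) ?_
    · exact h p ((hA' p w).2 ⟨hp, hpw⟩)
    · rintro ⟨h1, p, q, hp, hq, hpq⟩
      rw [hA'] at hp hq
      exact ⟨h1, p, q, hp.1, hp.2, hq.1, hq.2, hpq⟩
  · rw [h.deg, Set.ncard_eq_zero (Set.toFinite _), Set.eq_empty_iff_forall_notMem]
    rintro p ⟨hp, hpc, hn⟩
    exact hn ((hA' p c).2 ⟨hp, hpc⟩)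

/-- The first traversal finds all reachable vertices, so its counters are the numbers of arcs still
unprocessed by the second. By acyclicity, `s` is the only reachable vertex that no arc from a
reachable vertex enters, hence the initial queue `[s]`. -/
theorem InDegreeInv.labelInv {n : ℕ} {G : Digraph (Fin n)} (hG : IsDAG G) {s : Fin n}
    {l₀ : ℕ → ℕ}
    {A : Finset (Fin n × Fin n)} {L : List (Fin n)} {D l : ℕ → ℕ}
    (h : InDegreeInv G s l₀ A L D l) (hA : ∀ p c, (p, c) ∈ A ↔ p ∈ L ∧ G.Adj p c)
    (hl : ∀ c : Fin n, l₀ c = 0) :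
    LabelInv G s ∅ [s] D (Function.update l s (s + 1)) := by
  have hL : ∀ c, c ∈ L ↔ Relation.ReflTransGen G.Adj s c := by
    refine fun c => ⟨h.reach c, fun hc => ?_⟩
    induction hc with
    | refl => exact (h.mem_iff s).2 (Or.inl rfl)
    | tail _ hpc ih => exact (h.mem_iff _).2 (Or.inr ⟨_, (hA _ _).2 ⟨ih, hpc⟩⟩)
  refine ⟨by simp, by simp, fun c => ?_, by simp, fun c => ?_, by simp, fun c hc _ => ?_,
    by simp⟩
  · rw [List.mem_singleton]
    constructor
    · rintro rfl
      exact ⟨.refl, fun p hp hpc => (hG.irrefl_of_reach hp hpc).elim⟩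
    · rintro ⟨hc, hc'⟩
      by_contra hcs
      obtain ⟨p, hp, hpc⟩ := exists_pred_of_reach hc hcs
      simpa using hc' p hp hpc
  · rw [h.deg]
    congr 1
    ext p
    simp [hA, hL]
  · rw [Function.update_of_ne (by simpa [Fin.val_inj] using hc), h.lab, hl]

/-! ### Programs that compute the labels. -/

/-- Append the vertex in register `10` to the queue if register `11` is `0`. -/
def pushIfZero : Program :=
  .ite (.eq 11 4) (block [.op (.store 9 6 10), .op (.inc 6)]) .skip

/-- Increment the in-degree of the vertex in register `10`. -/
def countArc : Program :=
  .seq (.op (.load 11 7 10)) (.seq pushIfZero (block [.op (.inc 11), .op (.store 7 10 11)]))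

/-- Put the proposal of the arc given by the registers `7` and `10` into register `12`. -/
def computeProposal : Program :=
  .ite (.eq 7 3) (block [.op (.copy 12 10), .op (.inc 12)]) (.op (.load 12 8 7))

/-- Update the label of the vertex in register `10` according to the proposal in register `12`. -/
def updateLabel : Program :=
  .seq (.op (.load 13 8 10))
    (.ite (.eq 13 4) (.op (.store 8 10 12))
      (.ite (.eq 13 12) .skip (block [.op (.copy 13 10), .op (.inc 13), .op (.store 8 10 13)])))

/-- Process an arc in the computation of the labels. -/
def labelArc : Program :=
  .seq computeProposal (.seq updateLabel
    (.seq (block [.op (.load 11 7 10), .op (.dec 11), .op (.store 7 10 11)]) pushIfZero))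

/-- Compute the labels for the vertex in register `3`. -/
def computeLabels : Program :=
  .seq (traverse countArc)
    (.seq (block [.op (.copy 11 3), .op (.inc 11), .op (.store 8 3 11)]) (traverse labelArc))

theorem State.setArr_self (σ : State) (A i : ℕ) : σ.setArr A i (σ.arr A i) = σ := by
  simp [State.setArr]

theorem State.setReg_setReg (σ : State) (x a b : ℕ) :
    (σ.setReg x a).setReg x b = σ.setReg x b := by
  simp [State.setReg]

section Labels

variable {n : ℕ} {G : Digraph (Fin n)} {adj : Fin n → List (Fin n)} {s : Fin n}

theorem countArc_spec (hG : IsDAG G) (hadj : IsAdjLists G adj) {σ₀ : State}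
    (h4 : σ₀.reg 4 = 0) (l₀ : ℕ → ℕ) :
    ArcSpec adj σ₀ (InDegreeInv G s l₀) countArc (cost countArc) := by
  intro A L σ w c hF hQ h7 h10 hw hc hA hX
  have h4' : σ.reg 4 = 0 := by rw [hF.1 4 (by norm_num), h4]
  have hX' := hX.insert_arc hG hw (((hadj w).2 c).1 hc) hA
  refine haltsWithin_of_wp ?_
  simp only [countArc, pushIfZero, wp, block, Op.apply, Test.Holds, State.reg_setReg, h10, h4', if_true, if_false, Nat.reduceEqDiff]
  refine ⟨fun hD => ?_, fun hD => ?_⟩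
  · rw [if_pos hD] at hX'
    refine ⟨by simpa [frame_setReg, frame_setArr] using hF, ?_, ?_, ?_, ?_, L ++ [c],
      ⟨[c], rfl⟩, ?_, ?_⟩
    all_goals try simp [State.reg_setReg, State.reg_setArr]
    · apply hQ.push
      · simp [State.reg_setReg, State.reg_setArr]
      · simp [State.arr_setArr, State.arr_setReg, h10]
    · simpa [State.arr_setArr, State.arr_setReg, State.reg_setReg, State.reg_setArr, h10] using hX'
  · rw [if_neg hD] at hX'
    refine ⟨by simpa [frame_setReg, frame_setArr] using hF, ?_, ?_, ?_, ?_, L,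
      List.prefix_refl L, ?_, ?_⟩
    all_goals try simp [State.reg_setReg, State.reg_setArr]
    · exact hQ.of_eq (by simp [State.reg_setReg, State.reg_setArr])
        (by simp [State.arr_setArr, State.arr_setReg])
    · simpa [State.arr_setArr, State.arr_setReg, State.reg_setReg, State.reg_setArr, h10] using hX'

theorem labelArc_spec (hG : IsDAG G) (hadj : IsAdjLists G adj) {σ₀ : State}
    (h4 : σ₀.reg 4 = 0) (h3 : σ₀.reg 3 = s) :
    ArcSpec adj σ₀ (LabelInv G s) labelArc (cost labelArc) := by
  intro A L σ w c hF hQ h7 h10 hw hc hA hX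
  have h4' : σ.reg 4 = 0 := by rw [hF.1 4 (by norm_num), h4]
  have h3' : σ.reg 3 = s := by rw [hF.1 3 (by norm_num), h3]
  have hX' := hX.insert_arc hG hw (((hadj w).2 c).1 hc) hA
  refine (HaltsWithin.seq (R := fun σ' => σ' = σ.setReg 12 (proposal s (σ.arr 8) w c))
    (haltsWithin_of_wp ?_) fun σ₁ h₁ => HaltsWithin.seq
    (R := fun σ' => ∃ x, σ' = (σ₁.setReg 13 x).setArr 8 c
      (updatedLabel c (σ.arr 8 c) (proposal s (σ.arr 8) w c)))
    (haltsWithin_of_wp ?_) fun σ₂ h₂ => haltsWithin_of_wp ?_).mono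
    (B := cost computeProposal + (cost updateLabel + cost (.seq (block [.op (.load 11 7 10),
      .op (.dec 11), .op (.store 7 10 11)]) pushIfZero))) le_rfl fun _ h => h
  · simp only [computeProposal, wp, block, Op.apply, Test.Holds, State.reg_setReg, h7, h10, h3',
      if_true, State.setReg_setReg, Fin.val_inj]
    refine ⟨fun h => ?_, fun h => ?_⟩
    · rw [proposal, if_pos h]
    · rw [proposal, if_neg h]
  · subst h₁
    simp only [updateLabel, wp, block, Op.apply, Test.Holds, State.reg_setReg, State.arr_setReg,
      h10, h4', if_true, Nat.reduceEqDiff, if_false, State.setReg_setReg]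
    refine ⟨fun h => ⟨σ.arr 8 c, ?_⟩, fun h => ⟨fun h' => ⟨σ.arr 8 c, ?_⟩, fun h' => ⟨c + 1, ?_⟩⟩⟩
    · rw [updatedLabel, if_pos h]
    · rw [updatedLabel, if_neg h, if_pos h']
      -- The program writes nothing when the proposal agrees; this equals rewriting the old value.
      exact (State.setArr_self _ _ _).symm
    · rw [updatedLabel, if_neg h, if_neg h']
  · obtain ⟨x, rfl⟩ := h₂
    subst h₁
    simp only [pushIfZero, wp, block, Op.apply, Test.Holds, State.reg_setReg, State.arr_setReg,
      State.reg_setArr, State.arr_setArr, h10, h4', if_true, Nat.reduceEqDiff, if_false]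
    refine ⟨fun hD => ?_, fun hD => ?_⟩
    · rw [if_pos hD] at hX'
      refine ⟨by simpa [frame_setReg, frame_setArr] using hF, ?_, ?_, ?_, ?_, L ++ [c],
        ⟨[c], rfl⟩, ?_, ?_⟩
      iterate 4 trivial
      · apply hQ.push
        · simp [State.reg_setReg]
        · simp [State.arr_setArr, State.arr_setReg]
      · simpa [State.arr_setArr, State.arr_setReg] using hX'
    · rw [if_neg hD] at hX'
      refine ⟨by simpa [frame_setReg, frame_setArr] using hF, ?_, ?_, ?_, ?_, L,
        List.prefix_refl L, ?_, ?_⟩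
      iterate 4 trivial
      · exact hQ.of_eq (by simp [State.reg_setReg, State.reg_setArr])
          (by simp [State.arr_setArr, State.arr_setReg])
      · simpa [State.arr_setArr, State.arr_setReg] using hX'

/-- The final queue is exposed because it contains every vertex with nonzero label, so that the
labels can later be erased in time `O(m + 1)`. -/
theorem computeLabels_spec (hG : IsDAG G) (hadj : IsAdjLists G adj) {σ : State}
    (hin : HoldsAdjLists adj (σ.arr 0) (σ.arr 1)) (h3 : σ.reg 3 = s) (h4 : σ.reg 4 = 0)
    (h7 : ∀ c : Fin n, σ.arr 7 c = 0) (h8 : ∀ c : Fin n, σ.arr 8 c = 0) :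
    HaltsWithin computeLabels σ (100 * (arcCount G + 1)) fun σ' => Frame σ σ' ∧
      IsLabeling G s (σ'.arr 8) ∧ (∀ c : Fin n, σ'.arr 7 c = 0) ∧
      ∃ L : List (Fin n), HoldsQueue L σ' ∧ L.length ≤ arcCount G + 1 ∧
        ∀ c, Relation.ReflTransGen G.Adj s c → c ∈ L := by
  refine (HaltsWithin.seq (traverse_spec hadj hin h3 (fun A L D l h => ⟨h.nodup, h.length_le⟩)
    (countArc_spec (s := s) hG hadj h4 (σ.arr 8)) (Frame.refl σ) ?_) fun σ₁ h₁ =>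
    HaltsWithin.seq (R := fun σ' => Frame σ σ' ∧ LabelInv G s ∅ [s] (σ'.arr 7) (σ'.arr 8))
    (haltsWithin_of_wp ?_) fun σ₂ h₂ => traverse_spec hadj hin h3
    (fun A L D l h => ⟨h.nodup, h.length_le⟩) (labelArc_spec hG hadj h4 h3) h₂.1 h₂.2).mono
    ?_ ?_
  · exact ⟨by simp, by simp, by simp, by simp [Relation.ReflTransGen.refl], by simp [h7], rfl⟩
  · obtain ⟨hF, A, L, -, hA, hX⟩ := h₁
    have := hX.labelInv hG hA h8
    have h3' : σ₁.reg 3 = s := by rw [hF.1 3 (by norm_num), h3]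
    simp only [wp, block, Op.apply]
    refine ⟨by simpa [frame_setReg, frame_setArr] using hF, ?_⟩
    simpa [State.arr_setArr, State.arr_setReg, State.reg_setReg, h3'] using this
  · norm_num [cost, countArc, labelArc, computeProposal, updateLabel, pushIfZero, block]
    omega
  · rintro σ' ⟨hF, A, M, hQ, hA, hX⟩
    obtain ⟨hl, hD⟩ := hX.isLabeling hG hA
    refine ⟨hF, hl, hD, M, hQ, hX.length_le.trans ?_, fun c => hX.mem_of_reach hG hA⟩
    exact Nat.succ_le_succ (card_le_arcCount fun p c h => ((hA p c).1 h).2)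

end Labels

/-! ### Input encoding and the test of all pairs against one vertex. -/

section Programs

variable {n k : ℕ} {G : Digraph (Fin n)} {adj : Fin n → List (Fin n)}
  {pairs : Fin k → Fin n × Fin n}

theorem offsets_getD (adj : Fin n → List (Fin n)) {u : ℕ} (hu : u ≤ n) :
    (offsets adj).getD u 0 = ((List.ofFn adj).take u).flatten.length := by
  rw [offsets, List.getD_eq_getElem _ _ (by simpa using Nat.lt_succ_of_le hu)]
  simp

theorem holdsAdjLists_offsets (adj : Fin n → List (Fin n)) :
    HoldsAdjLists adj (fun i => (offsets adj).getD i 0) (fun i => (targets adj).getD i 0) := by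
  intro u
  have hu : (u : ℕ) < (List.ofFn adj).length := by simp
  refine ⟨?_, fun j hj => ?_⟩
  · change (offsets adj).getD (u + 1) 0 = (offsets adj).getD u 0 + _
    rw [offsets_getD adj (Nat.succ_le_of_lt u.2), offsets_getD adj u.2.le, List.take_succ_eq_append_getElem hu]
    simp
  · have h : (targets adj)[((List.ofFn adj).take u).flatten.length + j]? =
        some ((adj u)[j] : ℕ) := by
      have hsplit : List.ofFn adj =
          (List.ofFn adj).take u ++ adj u :: (List.ofFn adj).drop (u + 1) := by
        conv_lhs => rw [← List.take_append_drop u (List.ofFn adj), List.drop_eq_getElem_cons hu]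
        simp
      rw [targets, hsplit, List.flatten_append, List.flatten_cons, ← hsplit, List.getElem?_map,
        List.getElem?_append_right (by omega), Nat.add_sub_cancel_left,
        List.getElem?_append_left hj, List.getElem?_eq_getElem hj]
      rfl
    simp only [offsets_getD adj u.2.le, List.getD_eq_getElem?_getD, h, Option.getD_some]

/-- The state holds the numbers `n` and `k`, the zero constant, the graph and the pairs. -/
structure HoldsInput (adj : Fin n → List (Fin n)) (pairs : Fin k → Fin n × Fin n)
    (σ : State) : Prop where
  vertices : σ.reg 0 = n
  pairCount : σ.reg 2 = k
  zero : σ.reg 4 = 0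
  lists : HoldsAdjLists adj (σ.arr 0) (σ.arr 1)
  fst : ∀ i : Fin k, σ.arr 2 i = (pairs i).1
  snd : ∀ i : Fin k, σ.arr 3 i = (pairs i).2

theorem HoldsInput.of_eq {σ σ' : State} (h : HoldsInput adj pairs σ)
    (h0 : σ'.reg 0 = σ.reg 0) (h2 : σ'.reg 2 = σ.reg 2) (h4 : σ'.reg 4 = σ.reg 4)
    (harr : ∀ A < 4, σ'.arr A = σ.arr A) : HoldsInput adj pairs σ' := by
  refine ⟨h0.trans h.vertices, h2.trans h.pairCount, h4.trans h.zero, ?_, fun i => ?_, fun i => ?_⟩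
  · rw [harr 0 (by norm_num), harr 1 (by norm_num)]; exact h.lists
  · rw [harr 2 (by norm_num)]; exact h.fst i
  · rw [harr 3 (by norm_num)]; exact h.snd i

theorem HoldsInput.of_frame {σ σ' : State} (h : HoldsInput adj pairs σ) (hF : Frame σ σ') :
    HoldsInput adj pairs σ' :=
  h.of_eq (hF.1 _ (by norm_num)) (hF.1 _ (by norm_num)) (hF.1 _ (by norm_num))
    fun _ hA => hF.2 _ (by omega)

theorem holdsInput_init (adj : Fin n → List (Fin n)) (pairs : Fin k → Fin n × Fin n)
    {regs : List ℕ} (h0 : regs.getD 0 0 = n) (h2 : regs.getD 2 0 = k) (h4 : regs.getD 4 0 = 0) :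
    HoldsInput adj pairs (State.init regs (inputArrays adj pairs)) := by
  refine ⟨h0, h2, h4, holdsAdjLists_offsets adj, fun i => ?_, fun i => ?_⟩ <;>
  simp [State.init, inputArrays]

/-- Execute `act` if the vertex whose labels are in array `8` is a junction of the pair with the
number in register `5`. -/
def onJunction (act : Program) : Program :=
  .seq (block [.op (.load 11 2 5), .op (.load 12 3 5), .op (.load 13 8 11), .op (.load 14 8 12)])
    (.ite (.eq 13 4) .skip (.ite (.eq 14 4) .skip (.ite (.eq 13 14) .skip act)))

/-- Execute `onJunction act` for every pair. -/
def forPairs (act : Program) : Program :=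
  .seq (.op (.const 5 0)) (.loop (.lt 5 2) (.seq (onJunction act) (.op (.inc 5))))

/-- `I j` describes the state after the first `j` pairs. `hcongr` makes it insensitive to the loop
counter in register `5` and to the scratch registers from `11` on, which the test overwrites; `hno`
covers pairs for which nothing is written. -/
theorem forPairs_spec {s : Fin n} (hG : IsDAG G) {act : Program} {I : ℕ → State → Prop}
    (hI : ∀ j σ, I j σ → HoldsInput adj pairs σ ∧ IsLabeling G s (σ.arr 8))
    (hcongr : ∀ j σ σ', σ'.arr = σ.arr → (∀ x < 11, x ≠ 5 → σ'.reg x = σ.reg x) →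
      I j σ → I j σ')
    (hyes : ∀ (i : Fin k) σ, I i σ → σ.reg 5 = i → IsJunction G s (pairs i).1 (pairs i).2 →
      wp act (fun σ' => I ((i : ℕ) + 1) σ' ∧ σ'.reg 5 = i) σ)
    (hno : ∀ (i : Fin k) σ, I i σ → ¬ IsJunction G s (pairs i).1 (pairs i).2 → I (i + 1) σ)
    {σ : State} (h0 : I 0 σ) :
    HaltsWithin (forPairs act) σ ((cost act + 20) * (k + 1)) (I k) := by
  refine (HaltsWithin.seq (R := fun σ => I 0 σ ∧ σ.reg 5 = 0) (haltsWithin_of_wp ?_)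
    fun σ₁ h₁ => HaltsWithin.for (fun j σ => I j σ ∧ σ.reg 5 = j) k
    (cost (.seq (onJunction act) (.op (.inc 5)))) ?_ ?_ h₁).mono ?_ fun _ h => h.1
  · refine ⟨hcongr 0 σ _ rfl (fun x _ hx => ?_) h0, ?_⟩ <;> simp_all [Op.apply, State.reg_setReg]
  · rintro j τ ⟨hIj, h5⟩
    simp only [Test.Holds, h5, (hI j τ hIj).1.pairCount]
  · rintro j τ ⟨hIj, h5⟩ hj
    obtain ⟨hin, hl⟩ := hI j τ hIj
    obtain ⟨i, rfl⟩ : ∃ i : Fin k, (i : ℕ) = j := ⟨⟨j, hj⟩, rfl⟩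
    have hiff := hl.isJunction_iff hG (u := (pairs i).1) (v := (pairs i).2)
    have hskip : ∀ τ' : State, (τ'.arr = τ.arr) → (∀ x < 11, τ'.reg x = τ.reg x) →
        ¬ IsJunction G s (pairs i).1 (pairs i).2 →
        I ((i : ℕ) + 1) (τ'.setReg 5 (τ'.reg 5 + 1)) ∧
          (τ'.setReg 5 (τ'.reg 5 + 1)).reg 5 = i + 1 := by
      intro τ' ha hr hn
      refine ⟨hno i _ (hcongr i τ _ ha (fun x hx hx' => ?_) hIj) hn, ?_⟩
      · rw [State.reg_setReg, if_neg hx', hr x hx]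
      · rw [State.reg_setReg, if_pos rfl, hr 5 (by norm_num), h5]
    have hact : ∀ τ' : State, (τ'.arr = τ.arr) → (∀ x < 11, τ'.reg x = τ.reg x) →
        IsJunction G s (pairs i).1 (pairs i).2 →
        wp act (fun σ' => I ((i : ℕ) + 1) σ' ∧ σ'.reg 5 = i) τ' := fun τ' ha hr hJ =>
      hyes i τ' (hcongr i τ τ' ha (fun x hx _ => hr x hx) hIj)
        ((hr 5 (by norm_num)).trans h5) hJ
    set τ' := (((τ.setReg 11 (pairs i).1).setReg 12 (pairs i).2).setReg 13
      (τ.arr 8 (pairs i).1)).setReg 14 (τ.arr 8 (pairs i).2) with hτ'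
    have hload : wp (block [.op (.load 11 2 5), .op (.load 12 3 5), .op (.load 13 8 11),
        .op (.load 14 8 12)]) (fun σ => σ = τ') τ := by
      simp only [wp, block, Op.apply, State.reg_setReg, State.arr_setReg, h5, hin.fst, hin.snd,
        if_true, Nat.reduceEqDiff, if_false, hτ']
    have ha : τ'.arr = τ.arr := rfl
    have hr : ∀ x < 11, τ'.reg x = τ.reg x := by
      intro x hx
      simp only [hτ', State.reg_setReg]
      rw [if_neg (by omega), if_neg (by omega), if_neg (by omega), if_neg (by omega)]
    have h4 : τ'.reg 4 = 0 := (hr 4 (by norm_num)).trans hin.zero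
    have h13 : τ'.reg 13 = τ.arr 8 (pairs i).1 := by simp [hτ', State.reg_setReg]
    have h14 : τ'.reg 14 = τ.arr 8 (pairs i).2 := by simp [hτ', State.reg_setReg]
    refine (HaltsWithin.seq (B₁ := cost (onJunction act)) (B₂ := 1)
      (R := fun σ => I ((i : ℕ) + 1) (σ.setReg 5 (σ.reg 5 + 1)) ∧
        (σ.setReg 5 (σ.reg 5 + 1)).reg 5 = i + 1)
      (HaltsWithin.seq (haltsWithin_of_wp hload) fun τ'' h'' => ?_) fun τ'' h'' =>
      haltsWithin_of_wp (p := .op (.inc 5)) h'')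
    subst h''
    by_cases hJ : IsJunction G s (pairs i).1 (pairs i).2
    · obtain ⟨h1, h2, h3⟩ := hiff.1 hJ
      have hw : HaltsWithin act τ' (cost act) _ := haltsWithin_of_wp (hact τ' ha hr hJ)
      obtain ⟨σ', t, hrun, ht, hI', h5'⟩ := hw
      refine ⟨σ', t + 1 + 1 + 1, .iteFalse ?_ (.iteFalse ?_ (.iteFalse ?_ hrun)), ?_, ?_, ?_⟩
      · simpa [Test.Holds, h13, h4] using h1
      · simpa [Test.Holds, h14, h4] using h2
      · simpa [Test.Holds, h13, h14] using h3
      · simp only [cost]; omega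
      · exact hcongr _ σ' _ rfl (fun x _ hx => by rw [State.reg_setReg, if_neg hx]) hI'
      · rw [State.reg_setReg, if_pos rfl, h5']
    · refine haltsWithin_of_wp ⟨fun _ => hskip τ' ha hr hJ, fun h1 => ⟨fun _ => hskip τ' ha hr hJ,
        fun h2 => ⟨fun _ => hskip τ' ha hr hJ, fun h3 => (hJ (hiff.2 ?_)).elim⟩⟩⟩
      simp only [Test.Holds, h13, h14, h4] at h1 h2 h3
      exact ⟨h1, h2, h3⟩
  · simp only [cost, onJunction, block]
    have : max 1 (max 1 (max 1 (cost act) + 1) + 1) + 1 ≤ cost act + 6 := by omega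
    nlinarith

/-- The program for the problem with a single vertex. -/
def singleProgram : Program :=
  .seq computeLabels (forPairs (block [.op (.const 15 1), .op (.store 4 5 15)]))

theorem singleProgram_spec (hG : IsDAG G) (hadj : IsAdjLists G adj) (s : Fin n)
    (pairs : Fin k → Fin n × Fin n) :
    HaltsWithin singleProgram (singleInput G adj s pairs) (200 * (arcCount G + k + 1))
      (SingleAnswer G s pairs) := by
  have hin : HoldsInput adj pairs (singleInput G adj s pairs) :=
    holdsInput_init adj pairs rfl rfl rfl
  -- Cells of pairs not yet treated are still `0`, which is already the correct negative answer.
  let I : ℕ → State → Prop := fun j σ => HoldsInput adj pairs σ ∧ IsLabeling G s (σ.arr 8) ∧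
    ∀ i : Fin k, ((i : ℕ) < j → (IsJunction G s (pairs i).1 (pairs i).2 → σ.arr 4 i = 1) ∧
      (¬ IsJunction G s (pairs i).1 (pairs i).2 → σ.arr 4 i = 0)) ∧
      (j ≤ (i : ℕ) → σ.arr 4 i = 0)
  refine (HaltsWithin.seq (computeLabels_spec hG hadj hin.lists rfl hin.zero ?_ ?_)
    fun σ₁ h₁ => forPairs_spec (pairs := pairs) (adj := adj) (s := s)
    (I := I) hG ?_ ?_ ?_ ?_ ?_).mono ?_ ?_
  · intro c; simp [singleInput, State.init, inputArrays]
  · intro c; simp [singleInput, State.init, inputArrays]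
  · exact fun j σ h => ⟨h.1, h.2.1⟩
  · rintro j σ σ' ha hr ⟨h1, h2, h3⟩
    refine ⟨h1.of_eq (hr _ ?_ ?_) (hr _ ?_ ?_) (hr _ ?_ ?_) fun A _ => by rw [ha],
      by rwa [ha], by rwa [ha]⟩ <;> norm_num
  · rintro i σ ⟨h1, h2, h3⟩ h5 hJ
    simp only [wp, block, Op.apply, State.reg_setReg, h5, if_true, Nat.reduceEqDiff, if_false]
    refine ⟨⟨h1.of_eq ?_ ?_ ?_ fun A hA => ?_, ?_, fun i' => ?_⟩, ?_⟩
    iterate 3 simp [State.reg_setReg, State.reg_setArr]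
    · rw [State.arr_setArr, if_neg (by omega), State.arr_setReg]
    · simpa [State.arr_setArr, State.arr_setReg] using h2
    · by_cases hi : i' = i
      · subst hi
        simp [State.arr_setArr, hJ]
      · have hi' : (i' : ℕ) ≠ i := by simpa [Fin.val_inj] using hi
        simp only [State.arr_setArr, if_true, State.arr_setReg, Function.update_of_ne hi']
        exact ⟨fun h => (h3 i').1 (by omega), fun h => (h3 i').2 (by omega)⟩
    · simp [State.reg_setReg, State.reg_setArr, h5]
  · rintro i σ ⟨h1, h2, h3⟩ hJ
    refine ⟨h1, h2, fun i' => ⟨fun h => ?_, fun h => (h3 i').2 (by omega)⟩⟩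
    by_cases hi : i' = i
    · subst hi
      exact ⟨fun h => absurd h hJ, fun _ => (h3 i').2 le_rfl⟩
    · have hi' : (i' : ℕ) ≠ i := by simpa [Fin.val_inj] using hi
      exact (h3 i').1 (by omega)
  · refine ⟨hin.of_frame h₁.1, h₁.2.1, fun i => ⟨by simp, fun _ => ?_⟩⟩
    rw [h₁.1.2 4 (by norm_num)]
    simp [singleInput, State.init, inputArrays]
  · simp only [cost, block]
    omega
  · rintro σ ⟨-, -, h⟩ i
    exact (h i).1 i.2

/-! ### Listing all junctions of every pair. -/

/-- The cells of array `a₆` from position `i * n` up to, not including, position `a₅ i` list the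
vertices satisfying `P`. -/
def Lists (a₅ a₆ : ℕ → ℕ) (i : ℕ) (P : Fin n → Prop) : Prop :=
  ∃ L : List (Fin n), L.Nodup ∧ (∀ x, x ∈ L ↔ P x) ∧ a₅ i = i * n + L.length ∧
    ∀ (t : ℕ) (ht : t < L.length), a₆ (i * n + t) = L[t]

theorem Lists.congr {a₅ a₆ : ℕ → ℕ} {i : ℕ} {P Q : Fin n → Prop} (h : Lists a₅ a₆ i P)
    (hPQ : ∀ x, P x ↔ Q x) : Lists a₅ a₆ i Q := by
  obtain rfl : P = Q := funext fun x => propext (hPQ x)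
  exact h

theorem Lists.append {a₅ a₆ : ℕ → ℕ} {i : ℕ} {P : Fin n → Prop} (h : Lists a₅ a₆ i P)
    {s : Fin n} (hs : ¬ P s) :
    Lists (Function.update a₅ i (a₅ i + 1)) (Function.update a₆ (a₅ i) s) i
      (fun x => P x ∨ x = s) := by
  obtain ⟨L, hnd, hP, h5, h6⟩ := h
  refine ⟨L ++ [s], ?_, fun x => by simp [hP], ?_, fun t ht => ?_⟩
  · exact List.nodup_append.2 ⟨hnd, by simp, by
      intro a ha b hb; rw [List.mem_singleton.1 hb]; rintro rfl; exact hs ((hP a).1 ha)⟩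
  · simp [h5, Nat.add_assoc]
  · rw [List.getElem_append, h5, Function.update_apply]
    split_ifs with h1 h2 h2
    · omega
    · simp
    · exact h6 t h2
    · simp at ht; omega

/-- Blocks of `n` cells do not overflow: since `s` is not yet listed, the list of pair `i` has fewer
than `n` entries, so the new entry stays in block `i`, disjoint from block `i'`. -/
theorem Lists.update_of_ne {a₅ a₆ : ℕ → ℕ} {i i' : ℕ} {P P' : Fin n → Prop}
    (h : Lists a₅ a₆ i P) (h' : Lists a₅ a₆ i' P') {s : Fin n} (hs : ¬ P s) (hi : i' ≠ i)
    (y : ℕ) :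
    Lists (Function.update a₅ i y) (Function.update a₆ (a₅ i) s) i' P' := by
  obtain ⟨L, hnd, hP, h5, -⟩ := h
  obtain ⟨L', hnd', hP', h5', h6'⟩ := h'
  refine ⟨L', hnd', hP', by rw [Function.update_of_ne hi, h5'], fun t ht => ?_⟩
  have hL : L.length + 1 ≤ n := by
    have : (s :: L).Nodup := List.nodup_cons.2 ⟨fun h => hs ((hP s).1 h), hnd⟩
    simpa using this.length_le_card
  have hL' : L'.length ≤ n := by simpa using hnd'.length_le_card
  rw [Function.update_of_ne, h6' t ht]
  rw [h5]
  intro he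
  rcases Nat.lt_or_gt_of_ne hi with hlt | hlt
  · have := Nat.mul_le_mul_right n (Nat.succ_le_of_lt hlt)
    rw [Nat.succ_mul] at this
    omega
  · have := Nat.mul_le_mul_right n (Nat.succ_le_of_lt hlt)
    rw [Nat.succ_mul] at this
    omega

/-- Write the vertex in register `3` to the list of the pair with the number in register `5`. -/
def record : Program :=
  block [.op (.load 15 5 5), .op (.store 6 15 3), .op (.inc 15), .op (.store 5 5 15)]

/-- Set the labels of all vertices of the queue to `0`. -/
def clearLabels : Program :=
  .seq (.op (.const 5 0))
    (.loop (.lt 5 6) (block [.op (.load 7 9 5), .op (.store 8 7 4), .op (.inc 5)]))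

/-- Set the cells `i` of the arrays `4` and `5` to `i * n` for every pair. -/
def initPositions : Program :=
  .seq (block [.op (.const 5 0), .op (.const 6 0)])
    (.loop (.lt 5 2)
      (.seq (block [.op (.store 4 5 6), .op (.store 5 5 6), .op (.const 7 0)])
        (.seq (.loop (.lt 7 0) (block [.op (.inc 6), .op (.inc 7)])) (.op (.inc 5)))))

/-- The program for the problem `k`-pairs-all-junctions. -/
def allProgram : Program :=
  .ite (.lt 4 2)
    (.seq initPositions
      (.loop (.lt 3 0)
        (.seq computeLabels (.seq (forPairs record) (.seq clearLabels (.op (.inc 3)))))))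
    .skip

/-- Erasing only along the queue avoids a pass over all `n` vertices. After `j` passes, nonzero
labels occur only in the rest of the queue. -/
theorem clearLabels_spec {σ : State} {L : List (Fin n)} (hQ : HoldsQueue L σ)
    (h4 : σ.reg 4 = 0) (hL : ∀ c : Fin n, σ.arr 8 c ≠ 0 → c ∈ L) :
    HaltsWithin clearLabels σ (10 * (L.length + 1)) fun σ' =>
      (∀ x < 5, σ'.reg x = σ.reg x) ∧ (∀ A < 8, σ'.arr A = σ.arr A) ∧
        ∀ c : Fin n, σ'.arr 8 c = 0 := by
  let I : ℕ → State → Prop := fun j τ => (∀ x < 5, τ.reg x = σ.reg x) ∧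
    (∀ A < 8, τ.arr A = σ.arr A) ∧ HoldsQueue L τ ∧ τ.reg 5 = j ∧
    ∀ c : Fin n, τ.arr 8 c ≠ 0 → c ∈ L.drop j
  refine (HaltsWithin.seq (R := I 0) (haltsWithin_of_wp (p := .op (.const 5 0)) ?_) fun σ₁ h₁ =>
    HaltsWithin.for I L.length
      (cost (block [.op (.load 7 9 5), .op (.store 8 7 4), .op (.inc 5)])) ?_ ?_ h₁).mono ?_ ?_
  · refine ⟨fun x hx => ?_, fun A _ => rfl, hQ.of_eq rfl rfl, ?_, hL⟩
    · rw [Op.apply, State.reg_setReg, if_neg (by omega)]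
    · rw [Op.apply, State.reg_setReg, if_pos rfl]
  · rintro j τ ⟨-, -, hQ', h5, -⟩
    simp only [Test.Holds, h5, hQ'.length]
  · rintro j τ ⟨hr, ha, hQ', h5, h8⟩ hj
    have h4' : τ.reg 4 = 0 := (hr 4 (by norm_num)).trans h4
    refine haltsWithin_of_wp ?_
    simp only [wp, block, Op.apply, State.reg_setReg, State.reg_setArr, h5,
      hQ'.get j hj, h4', if_true, Nat.reduceEqDiff, if_false]
    refine ⟨fun x hx => ?_, fun A hA => ?_, hQ'.of_eq ?_ ?_, ?_, fun c hc => ?_⟩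
    · simp only [State.reg_setReg, State.reg_setArr]
      rw [if_neg (by omega), if_neg (by omega), hr x hx]
    · simp only [State.arr_setReg, State.arr_setArr]
      rw [if_neg (by omega), ha A hA]
    · simp [State.reg_setReg, State.reg_setArr]
    · simp [State.arr_setReg, State.arr_setArr]
    · simp [State.reg_setReg]
    · simp only [State.arr_setReg, State.arr_setArr, if_true, Function.update_apply,
        Fin.val_inj] at hc
      split_ifs at hc with hcj
      · exact absurd rfl hc
      · have := h8 c hc
        rw [List.drop_eq_getElem_cons hj] at this
        exact (List.mem_cons.1 this).resolve_left hcj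
  · simp only [cost, block]; omega
  · rintro σ' ⟨hr, ha, -, -, h8⟩
    refine ⟨hr, ha, fun c => ?_⟩
    by_contra hc
    simpa using h8 c hc

/-- The machine cannot multiply, so register `6` is moved from `i * n` to `(i + 1) * n` by `n`
increments; this is affordable, as `O(n)` steps per pair are allowed. -/
theorem initPositions_spec {σ : State} (h0 : σ.reg 0 = n) (h2 : σ.reg 2 = k) :
    HaltsWithin initPositions σ (20 * ((n + 1) * (k + 1))) fun σ' =>
      (∀ x < 5, σ'.reg x = σ.reg x) ∧ (∀ A, A ≠ 4 → A ≠ 5 → σ'.arr A = σ.arr A) ∧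
        ∀ i < k, σ'.arr 4 i = i * n ∧ σ'.arr 5 i = i * n := by
  let I : ℕ → State → Prop := fun j τ => (∀ x < 5, τ.reg x = σ.reg x) ∧
    (∀ A, A ≠ 4 → A ≠ 5 → τ.arr A = σ.arr A) ∧ τ.reg 5 = j ∧ τ.reg 6 = j * n ∧
    ∀ i < j, τ.arr 4 i = i * n ∧ τ.arr 5 i = i * n
  let J : ℕ → ℕ → State → Prop := fun j t τ => (∀ x < 5, τ.reg x = σ.reg x) ∧
    (∀ A, A ≠ 4 → A ≠ 5 → τ.arr A = σ.arr A) ∧ τ.reg 5 = j ∧ τ.reg 6 = j * n + t ∧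
    τ.reg 7 = t ∧ ∀ i < j + 1, τ.arr 4 i = i * n ∧ τ.arr 5 i = i * n
  refine (HaltsWithin.seq (R := I 0) (haltsWithin_of_wp ?_) fun σ₁ h₁ =>
    HaltsWithin.for I k (3 * n + 5) ?_ ?_ h₁).mono ?_ ?_
  · simp only [wp, block, Op.apply]
    refine ⟨fun x hx => ?_, fun A _ _ => rfl, ?_, ?_, by simp⟩
    · simp only [State.reg_setReg]
      rw [if_neg (by omega), if_neg (by omega)]
    · simp [State.reg_setReg]
    · simp [State.reg_setReg]
  · rintro j τ ⟨hr, -, h5, -⟩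
    simp only [Test.Holds, h5, hr 2 (by norm_num), h2]
  · rintro j τ ⟨hr, ha, h5, h6, hi⟩ hj
    refine (HaltsWithin.seq (R := J j 0) (haltsWithin_of_wp ?_) fun τ₁ h₁ =>
      HaltsWithin.seq (HaltsWithin.for (J j) n 2 ?_ ?_ h₁) fun τ₂ h₂ =>
      haltsWithin_of_wp (p := .op (.inc 5)) ?_).mono ?_ fun _ h => h
    · simp only [wp, block, Op.apply, State.reg_setArr, h5, h6]
      refine ⟨fun x hx => ?_, fun A hA hA' => ?_, ?_, ?_, ?_, fun i hij => ?_⟩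
      · simp only [State.reg_setReg, State.reg_setArr]
        rw [if_neg (by omega), hr x hx]
      · simp only [State.arr_setReg, State.arr_setArr]
        rw [if_neg hA', if_neg hA, ha A hA hA']
      · simp [State.reg_setReg, State.reg_setArr, h5]
      · simp [State.reg_setReg, State.reg_setArr, h6]
      · simp [State.reg_setReg]
      · simp only [State.arr_setReg, State.arr_setArr, if_true, Nat.reduceEqDiff, if_false,
          Function.update_apply]
        split_ifs with hij'
        · rw [hij']; exact ⟨rfl, rfl⟩
        · exact hi i (by omega)
    · rintro t τ' ⟨hr', -, -, -, h7', -⟩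
      simp only [Test.Holds, h7', hr' 0 (by norm_num), h0]
    · rintro t τ' ⟨hr', ha', h5', h6', h7', hi'⟩ ht
      refine haltsWithin_of_wp (p := block [.op (.inc 6), .op (.inc 7)]) ?_
      simp only [wp, block, Op.apply]
      refine ⟨fun x hx => ?_, ha', ?_, ?_, ?_, hi'⟩
      · simp only [State.reg_setReg]
        rw [if_neg (by omega), if_neg (by omega), hr' x hx]
      · simp [State.reg_setReg, h5']
      · simp [State.reg_setReg, h6', Nat.add_assoc]
      · simp [State.reg_setReg, h7']
    · obtain ⟨hr', ha', h5', h6', h7', hi'⟩ := h₂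
      simp only [wp, Op.apply]
      refine ⟨fun x hx => ?_, ha', ?_, ?_, hi'⟩
      · rw [State.reg_setReg, if_neg (by omega), hr' x hx]
      · simp [State.reg_setReg, h5']
      · simp [State.reg_setReg, h6', Nat.succ_mul]
    · simp only [cost, block]; omega
  · simp only [cost, block]
    nlinarith
  · rintro σ' ⟨hr, ha, -, -, hi⟩
    exact ⟨hr, ha, hi⟩

theorem forPairs_record_spec (hG : IsDAG G) {s : Fin n} {σ : State}
    (hin : HoldsInput adj pairs σ) (h3 : σ.reg 3 = s) (hl : IsLabeling G s (σ.arr 8))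
    (hlists : ∀ i : Fin k, Lists (σ.arr 5) (σ.arr 6) i
      fun x => (x : ℕ) < s ∧ IsJunction G x (pairs i).1 (pairs i).2) :
    HaltsWithin (forPairs record) σ (24 * (k + 1)) fun σ' =>
      (∀ x < 11, x ≠ 5 → σ'.reg x = σ.reg x) ∧ (∀ A, A ≠ 5 → A ≠ 6 → σ'.arr A = σ.arr A) ∧
        ∀ i : Fin k, Lists (σ'.arr 5) (σ'.arr 6) i
          fun x => (x : ℕ) < s + 1 ∧ IsJunction G x (pairs i).1 (pairs i).2 := by
  -- All vertices before `s` are recorded for every pair, and `s` itself only for the first `j`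
  -- pairs.
  let P : ℕ → Fin k → Fin n → Prop := fun j i x =>
    ((x : ℕ) < s ∨ x = s ∧ (i : ℕ) < j) ∧ IsJunction G x (pairs i).1 (pairs i).2
  let I : ℕ → State → Prop := fun j τ => (∀ x < 11, x ≠ 5 → τ.reg x = σ.reg x) ∧
    (∀ A, A ≠ 5 → A ≠ 6 → τ.arr A = σ.arr A) ∧
    ∀ i : Fin k, Lists (τ.arr 5) (τ.arr 6) i (P j i)
  refine (forPairs_spec (I := I) (adj := adj) (pairs := pairs) (s := s) hG ?_ ?_ ?_ ?_ ?_).mono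
    le_rfl ?_
  · rintro j τ ⟨hr, ha, -⟩
    refine ⟨hin.of_eq (hr _ ?_ ?_) (hr _ ?_ ?_) (hr _ ?_ ?_) fun A hA => ha A ?_ ?_, ?_⟩
    all_goals try omega
    rw [ha 8 (by norm_num) (by norm_num)]; exact hl
  · rintro j τ τ' ha hr ⟨hr', ha', hi'⟩
    exact ⟨fun x hx hx' => (hr x hx hx').trans (hr' x hx hx'), by rwa [ha], by rwa [ha]⟩
  · rintro i τ ⟨hr, ha, hi⟩ h5 hJ
    have h3' : τ.reg 3 = s := (hr 3 (by norm_num) (by norm_num)).trans h3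
    have hs : ¬ P i i s := fun h => by
      rcases h.1 with h | h
      · exact lt_irrefl _ h
      · exact lt_irrefl _ h.2
    simp only [record, wp, block, Op.apply, State.reg_setReg, State.reg_setArr,
      h5, h3', if_true, Nat.reduceEqDiff, if_false]
    refine ⟨⟨fun x hx hx' => ?_, fun A hA hA' => ?_, fun i' => ?_⟩, ?_⟩
    · simp only [State.reg_setReg, State.reg_setArr]
      rw [if_neg (by omega), if_neg (by omega), hr x hx hx']
    · simp only [State.arr_setReg, State.arr_setArr]
      rw [if_neg hA, if_neg hA', ha A hA hA']
    · simp only [State.arr_setReg, State.arr_setArr, if_true, Nat.reduceEqDiff, if_false]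
      by_cases hii : i' = i
      · subst hii
        refine ((hi i').append hs).congr fun x => ?_
        constructor
        · rintro (⟨h | h, hx⟩ | rfl)
          · exact ⟨Or.inl h, hx⟩
          · exact absurd h.2 (lt_irrefl _)
          · exact ⟨Or.inr ⟨rfl, Nat.lt_succ_self _⟩, hJ⟩
        · rintro ⟨h | h, hx⟩
          · exact Or.inl ⟨Or.inl h, hx⟩
          · exact Or.inr h.1
      · have hii' : (i' : ℕ) ≠ i := by simpa [Fin.val_inj] using hii
        refine ((hi i).update_of_ne (hi i') hs hii' _).congr fun x => ?_
        have : (i' : ℕ) < i + 1 ↔ (i' : ℕ) < i := by omega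
        simp only [P, this]
    · trivial
  · rintro i τ ⟨hr, ha, hi⟩ hJ
    refine ⟨hr, ha, fun i' => (hi i').congr fun x => ?_⟩
    refine and_congr_left fun hx => or_congr_right (and_congr_right fun hxs => ?_)
    have : (i' : ℕ) ≠ i := by
      intro h
      obtain rfl := Fin.ext h
      exact hJ (hxs ▸ hx)
    omega
  · refine ⟨fun _ _ _ => rfl, fun _ _ _ => rfl, fun i => (hlists i).congr fun x => ?_⟩
    simp [P]
  · rintro σ' ⟨hr, ha, hi⟩
    refine ⟨hr, ha, fun i => (hi i).congr fun x => and_congr_left fun _ => ?_⟩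
    rw [Fin.ext_iff]
    have := i.2
    omega

theorem allProgram_spec (hG : IsDAG G) (hadj : IsAdjLists G adj)
    (pairs : Fin k → Fin n × Fin n) :
    HaltsWithin allProgram (allInput G adj pairs) (1000 * (n * (arcCount G + k) + 1))
      (AllAnswer G pairs) := by
  set σ₀ := allInput G adj pairs with hσ₀
  have hin : HoldsInput adj pairs σ₀ := holdsInput_init adj pairs rfl rfl rfl
  -- Without pairs, running the labelling for every vertex would cost order `n * (m + 1)`, which `n
  -- * m + 1` does not bound; the program stops at once instead.
  by_cases hk : k = 0
  · subst hk
    refine ⟨σ₀, 2, .iteFalse ?_ (.skip σ₀), by omega, fun i => i.elim0⟩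
    simp [Test.Holds, hin.pairCount]
  let M : ℕ → State → Prop := fun j τ => HoldsInput adj pairs τ ∧ τ.reg 3 = j ∧
    (∀ c : Fin n, τ.arr 7 c = 0) ∧ (∀ c : Fin n, τ.arr 8 c = 0) ∧
    ∀ i : Fin k, τ.arr 4 i = i * n ∧ Lists (τ.arr 5) (τ.arr 6) i
      fun x : Fin n => (x : ℕ) < j ∧ IsJunction G x (pairs i).1 (pairs i).2
  have main : HaltsWithin (.seq initPositions (.loop (.lt 3 0)
        (.seq computeLabels (.seq (forPairs record) (.seq clearLabels (.op (.inc 3)))))))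
        σ₀ (20 * ((n + 1) * (k + 1)) + ((100 * (arcCount G + 1) + (24 * (k + 1) +
          (10 * (arcCount G + 2) + 1)) + 1) * n + 1)) (M n) := by
    refine HaltsWithin.seq (R := M 0)
      ((initPositions_spec hin.vertices hin.pairCount).mono le_rfl ?_) fun σ₁ h₁ =>
      HaltsWithin.for M n _ ?_ ?_ h₁
    · rintro σ ⟨hr, ha, hi⟩
      refine ⟨hin.of_eq (hr _ (by norm_num)) (hr _ (by norm_num)) (hr _ (by norm_num))
        fun A hA => ha A (by omega) (by omega), (hr 3 (by norm_num)).trans rfl, fun c => ?_,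
        fun c => ?_, fun i => ⟨(hi i i.2).1, [], by simp, by simp, (hi i i.2).2, by simp⟩⟩
      · rw [ha 7 (by norm_num) (by norm_num)]
        simp [hσ₀, allInput, State.init, inputArrays]
      · rw [ha 8 (by norm_num) (by norm_num)]
        simp [hσ₀, allInput, State.init, inputArrays]
    · rintro j τ ⟨hin', h3, -⟩
      simp only [Test.Holds, h3, hin'.vertices]
    · rintro j τ ⟨hin', h3, h7, h8, hi⟩ hj
      obtain ⟨s, rfl⟩ : ∃ s : Fin n, (s : ℕ) = j := ⟨⟨j, hj⟩, rfl⟩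
      refine HaltsWithin.seq (computeLabels_spec hG hadj hin'.lists h3 hin'.zero h7 h8)
        fun τ₁ h₁ => ?_
      obtain ⟨hF, hl, h7₁, L, hQ, hLm, hL⟩ := h₁
      have hin₁ := hin'.of_frame hF
      refine HaltsWithin.seq (forPairs_record_spec hG hin₁ ((hF.1 3 (by norm_num)).trans h3) hl
        fun i => ?_) fun τ₂ h₂ => ?_
      · rw [hF.2 5 (by norm_num), hF.2 6 (by norm_num)]
        exact (hi i).2
      obtain ⟨hr₂, ha₂, hi₂⟩ := h₂
      have h8₂ : τ₂.arr 8 = τ₁.arr 8 := ha₂ 8 (by norm_num) (by norm_num)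
      refine HaltsWithin.seq ((clearLabels_spec (L := L) (hQ.of_eq
        (hr₂ 6 (by norm_num) (by norm_num)) (ha₂ 9 (by norm_num) (by norm_num)))
        ((hr₂ 4 (by norm_num) (by norm_num)).trans hin₁.zero) ?_).mono (by omega)
        fun _ h => h) fun τ₃ h₃ => haltsWithin_of_wp (p := .op (.inc 3)) ?_
      · intro c hc
        rw [h8₂] at hc
        exact hL c ((hl.ne_zero_iff c).1 hc)
      obtain ⟨hr₃, ha₃, h8₃⟩ := h₃
      have hr : ∀ x < 5, τ₃.reg x = τ.reg x := fun x hx =>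
        (hr₃ x hx).trans ((hr₂ x (by omega) (by omega)).trans (hF.1 x hx))
      have ha : ∀ A < 5, τ₃.arr A = τ.arr A := fun A hA =>
        (ha₃ A (by omega)).trans ((ha₂ A (by omega) (by omega)).trans (hF.2 A (by omega)))
      simp only [wp, Op.apply]
      refine ⟨hin'.of_eq ?_ ?_ ?_ fun A hA => ha A (by omega), ?_, fun c => ?_, h8₃,
        fun i => ⟨?_, ?_⟩⟩
      · simpa [State.reg_setReg] using hr 0 (by norm_num)
      · simpa [State.reg_setReg] using hr 2 (by norm_num)
      · simpa [State.reg_setReg] using hr 4 (by norm_num)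
      · simp [State.reg_setReg, hr 3, h3]
      · rw [State.arr_setReg, ha₃ 7 (by norm_num), ha₂ 7 (by norm_num) (by norm_num), h7₁]
      · rw [State.arr_setReg, ha 4 (by norm_num), (hi i).1]
      · rw [State.arr_setReg, ha₃ 5 (by norm_num), ha₃ 6 (by norm_num)]
        exact hi₂ i
  obtain ⟨σ, t, hrun, ht, hM⟩ := main
  refine ⟨σ, t + 1, .iteTrue ?_ hrun, ?_, fun i => ?_⟩
  · simp only [Test.Holds, hin.zero, hin.pairCount]; omega
  · obtain ⟨k, rfl⟩ : ∃ k', k = k' + 1 := ⟨k - 1, by omega⟩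
    -- A pair exists, so `n ≥ 1` and `k ≥ 1`; hence `(n + 1) * (k + 1)` and `n * (m + k + 1)` are
    -- both at most a constant times `n * (m + k)`.
    have hn : 1 ≤ n := (pairs 0).1.pos
    nlinarith [Nat.mul_le_mul hn (Nat.zero_le k), Nat.zero_le (n * arcCount G),
      Nat.zero_le (n * k), Nat.mul_le_mul_right k hn]
  · obtain ⟨L, hnd, hmem, h5, h6⟩ := (hM.2.2.2.2 i).2
    have h4 := (hM.2.2.2.2 i).1
    refine ⟨L, hnd, fun s => ?_, by rw [h5, h4], fun j hj => by rw [h4, h6 j hj]⟩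
    rw [hmem]
    exact and_iff_right s.2

end Programs

end JunctionDAG

theorem corollary1 :
    (∃ (p : JunctionDAG.Program) (C : ℕ),
      ∀ (n k : ℕ) (G : Digraph (Fin n)) (adj : Fin n → List (Fin n)) (s : Fin n)
        (pairs : Fin k → Fin n × Fin n),
        JunctionDAG.IsDAG G → JunctionDAG.IsAdjLists G adj →
        ∃ (σ : JunctionDAG.State) (t : ℕ),
          JunctionDAG.Runs p (JunctionDAG.singleInput G adj s pairs) σ t ∧
          t ≤ C * (JunctionDAG.arcCount G + k + 1) ∧
          JunctionDAG.SingleAnswer G s pairs σ) ∧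
    (∃ (p : JunctionDAG.Program) (C : ℕ),
      ∀ (n k : ℕ) (G : Digraph (Fin n)) (adj : Fin n → List (Fin n))
        (pairs : Fin k → Fin n × Fin n),
        JunctionDAG.IsDAG G → JunctionDAG.IsAdjLists G adj →
        ∃ (σ : JunctionDAG.State) (t : ℕ),
          JunctionDAG.Runs p (JunctionDAG.allInput G adj pairs) σ t ∧
          t ≤ C * (n * (JunctionDAG.arcCount G + k) + 1) ∧
          JunctionDAG.AllAnswer G pairs σ) :=
  ⟨⟨JunctionDAG.singleProgram, 200, fun _ _ _ _ s pairs hG hadj =>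
      JunctionDAG.singleProgram_spec hG hadj s pairs⟩,
    ⟨JunctionDAG.allProgram, 1000, fun _ _ _ _ pairs hG hadj =>
      JunctionDAG.allProgram_spec hG hadj pairs⟩⟩
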